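/- **Setting.** Consider a finite-horizon Markov decision process with measurable observation space $\mathcal X$, measurable action space $\mathcal A$, horizon $H\ge 1$, fixed initial state $x_1$, transition kernels $P_h:\mathcal X\times\mathcal A\to\Delta(\mathcal X)$ and conditional cost distributions $C_h:\mathcal X\times\mathcal A\to\Delta([0,1])$, $h\in[H]$. Rolling in a policy $\pi=(\pi_h)_{h\in[H]}$, $\pi_h:\mathcal X\to\Delta(\mathcal A)$, means drawing $a_h\sim\pi_h(x_h)$ and then, independently given $(x_h,a_h)$, $c_h\sim C_h(x_h,a_h)$ and $x_{h+1}\sim P_h(x_h,a_h)$. Put $Z^\pi=\sum_{h=1}^H c_h$, $V^\pi=\mathbb E[Z^\pi]$, $\sigma^2(\pi)=\operatorname{Var}(Z^\pi)$, and let $d^\pi_h$ be the law of $(x_h,a_h)$ under $\pi$. Let $\lambda$ be an s-finite measure carried by $[0,1]$, and let $\mathcal P=\mathcal P_1\times\dots\times\mathcal P_H$, where each $\mathcal P_h$ is a nonempty finite set of (jointly measurable) conditional densities $p_h(y\mid x,a)$ with respect to $\lambda$; $p_{H+1}$ denotes the point mass at $0$, and $\bar p_h(x,a)$ is the mean of $p_h(\cdot\mid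 x,a)$. For each $p\in\mathcal P$ let $\pi_{\bar p}$ be a measurable deterministic policy with $\pi_{\bar p,h}(x)\in\arg\min_a\bar p_h(x,a)$ for all $h,x$ (one selection for each $p$), and let $\Pi_{\mathcal P}=\{\pi_{\bar p}:p\in\mathcal P\}$. The distributional Bellman operator is $\mathcal T^{D,\pi}_h g(x,a)=\text{law of }c+Z$, where $c\sim C_h(x,a)$ and $x'\sim P_h(x,a)$ are independent, $a'\sim\pi_{h+1}(x')$ and $Z\sim g(x',a')$. *Policy-wise distributional Bellman completeness:* $\mathcal T^{D,\pi}_h p_{h+1}\in\mathcal P_h$ for all $h\in[H]$, $p_{h+1}\in\mathcal P_{h+1}$, $\pi\in\Pi_{\mathcal P}$ (that is, some density in $\mathcal P_h$ represents $\mathcal T^{D,\pi}_h p_{h+1}(x,a)$ for all $(x,a)$). *Data.* Let $\nu_1,\dots,\nu_H$ be probability measures on $\mathcal X\times\mathcal A$ and $n\ge1$. For each $h$ we have $n$ i.i.d. samples $(x_{h,i},a_{h,i},c_{h,i},x'_{h,i})$ with $(x_{h,i},a_{h,i})\sim\nu_h$, $c_{h,i}\sim C_h(x_{h,i},a_{h,i})$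 and $x'_{h,i}\sim P_h(x_{h,i},a_{h,i})$, independently given $(x_{h,i},a_{h,i})$. For each $p_{h+1}\in\mathcal P_{h+1}$ and $\pi\in\Pi_{\mathcal P}$ we also have draws $Z_{h,i}\sim p_{h+1}(x'_{h,i},a')$, $a'\sim\pi_{h+1}(x'_{h,i})$ (conditionally on the $i$-th sample), such that the samples together with the draws are i.i.d. over $i$. The coverage coefficient is $C^{\pi}=\max_h\|\mathrm d d^{\pi}_h/\mathrm d\nu_h\|_\infty$ ($=\infty$ if some $d^\pi_h\not\ll\nu_h$). *Algorithm (pessimistic offline distributional RL with threshold $\beta$).* For $q\in\mathcal P_h$ let $L_h(q,p_{h+1},\pi)=\sum_{i=1}^n-\ln q(c_{h,i}+Z_{h,i}\mid x_{h,i},a_{h,i})\in(-\infty,+\infty]$, with the draws $Z_{h,i}$ belonging to $(p_{h+1},\pi)$. For each $\pi\in\Pi_{\mathcal P}$ form the version space $$\mathcal P_\pi=\Big\{p\in\mathcal P:\ \forall h\in[H],\ L_h(p_h,p_{h+1},\pi)\le\min_{q\in\mathcal P_h}L_h(q,p_{h+1},\pi)+\beta\Big\},$$ choose $p^\pi\in\arg\max_{p\in\mathcal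 P_\pi}\bar p_1(x_1,\pi)$, and return $\hat\pi\in\arg\min_{\pi\in\Pi_{\mathcal P}}\bar p^{\pi}_1(x_1,\pi)$, where $\bar p_1(x_1,\pi)=\mathbb E_{a\sim\pi_1(x_1)}\bar p_1(x_1,a)$; ties are broken arbitrarily. **Theorem.** There is a universal constant $K>0$ such that in every such setting, under policy-wise distributional Bellman completeness, for every $\delta\in(0,1)$ and with $\beta=2\ln(H|\mathcal P|/\delta)$, the following holds with probability at least $1-\delta$: the algorithm has an output, and for every output $\hat\pi$ and, simultaneously, every comparator $\tilde\pi\in\Pi_{\mathcal P}$ with $C^{\tilde\pi}<\infty$, $$V^{\hat\pi}-V^{\tilde\pi}\le K\left(H\sqrt{\sigma^2(\tilde\pi)\cdot\frac{C^{\tilde\pi}\beta}{n}}+H^{2.5}\,\frac{C^{\tilde\pi}\beta}{n}\right).$$ -/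

import Mathlib

open MeasureTheory ProbabilityTheory
open scoped ENNReal NNReal ProbabilityTheory

noncomputable section

namespace OfflineDistRL

/-! Steps are indexed by `Fin H`, so the step `h` of the usual numbering `1, …, H` is the index
`h - 1`; the initial step is `0`. -/

/-- A finite-horizon Markov decision process with observation space `X`, action space `A`,
horizon `H`, a fixed initial state, transition kernels and conditional cost distributions on
`[0, 1]`. -/
structure MDP (X A : Type*) [MeasurableSpace X] [MeasurableSpace A] (H : ℕ) where
  init : X
  trans : Fin H → Kernel (X × A) X
  cost : Fin H → Kernel (X × A) ℝ
  markov_trans : ∀ h, IsMarkovKernel (trans h)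
  markov_cost : ∀ h, IsMarkovKernel (cost h)
  cost_mem : ∀ h z, ∀ᵐ c ∂(cost h z), c ∈ Set.Icc (0 : ℝ) 1

/-- A policy `π = (π_h)`, where `π_h` maps observations to distributions over actions. -/
structure Policy (X A : Type*) [MeasurableSpace X] [MeasurableSpace A] (H : ℕ) where
  act : Fin H → Kernel X A
  markov_act : ∀ h, IsMarkovKernel (act h)

attribute [instance] MDP.markov_trans MDP.markov_cost Policy.markov_act

/-- A conditional distribution `X × A → Δ([0, 1])`, given by its density with respect to the
base measure `lam` (which will be carried by `[0, 1]`). -/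
structure CondDist (X A : Type*) [MeasurableSpace X] [MeasurableSpace A] (lam : Measure ℝ) where
  density : X × A → ℝ → ℝ≥0
  measurable_density : Measurable (Function.uncurry density)
  lintegral_density : ∀ z, ∫⁻ y, (density z y : ℝ≥0∞) ∂lam = 1

variable {X A : Type*} [MeasurableSpace X] [MeasurableSpace A] {H n : ℕ}

/-! ### Rolling in a policy -/

/-- The law of `(c_h, x_{h+1})` given `(x_h, a_h)`: cost and next state are drawn
independently. -/
def MDP.step (M : MDP X A H) (h : Fin H) : Kernel (X × A) (ℝ × X) :=
  M.cost h ×ₖ M.trans h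

/-- Law of `(x, a)` given `x`, where `a ∼ κ(x)`. -/
def withAction (κ : Kernel X A) : Kernel X (X × A) := Kernel.id ×ₖ κ

/-- Joint law, after `t` steps of rolling in `π` from the initial state, of the current state
and of the cost accumulated so far. -/
def rollIn (M : MDP X A H) (π : Policy X A H) : ℕ → Measure (X × ℝ)
  | 0 => Measure.dirac (M.init, 0)
  | t + 1 =>
    if ht : t < H then
      (rollIn M π t ⊗ₘ
        (M.step ⟨t, ht⟩ ∘ₖ withAction (π.act ⟨t, ht⟩)).comap Prod.fst measurable_fst).map
        (fun w => (w.2.2, w.1.2 + w.2.1))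
    else rollIn M π t

/-- The law of the cumulative cost `Z^π`. -/
def returnLaw (M : MDP X A H) (π : Policy X A H) : Measure ℝ := (rollIn M π H).map Prod.snd

/-- The value `V^π = E[Z^π]`. -/
def value (M : MDP X A H) (π : Policy X A H) : ℝ := ∫ z, z ∂(returnLaw M π)

/-- The variance `σ²(π)` of the cumulative cost `Z^π`. -/
def returnVariance (M : MDP X A H) (π : Policy X A H) : ℝ := variance id (returnLaw M π)

/-- The state-action visitation distribution `d^π_h`, the law of `(x_h, a_h)` under `π`. -/
def visitation (M : MDP X A H) (π : Policy X A H) (h : Fin H) : Measure (X × A) :=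
  (rollIn M π h).map Prod.fst ⊗ₘ π.act h

open Classical in
/-- The single-policy coverage coefficient `C^π = max_h ‖d d^π_h / d ν_h‖_∞ ∈ [0, ∞]`, infinite
if some `d^π_h` is not absolutely continuous with respect to `ν_h`. -/
def coverage (M : MDP X A H) (ν : Fin H → Measure (X × A)) (π : Policy X A H) : ℝ≥0∞ :=
  ⨆ h, if visitation M π h ≪ ν h then essSup ((visitation M π h).rnDeriv (ν h)) (ν h) else ⊤

/-! ### Conditional distributions and the distributional Bellman operator -/

variable {lam : Measure ℝ} [SFinite lam]

/-- The Markov kernel `(x, a) ↦ p(x, a)` with the given densities. -/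
def CondDist.toKernel (p : CondDist X A lam) : Kernel (X × A) ℝ :=
  (Kernel.const (X × A) lam).withDensity fun z y => (p.density z y : ℝ≥0∞)

/-- The mean `p̄(x, a)`. -/
def CondDist.mean (p : CondDist X A lam) (z : X × A) : ℝ := ∫ y, y ∂(p.toKernel z)

/-- The conditional distribution at the step after `h`, with the convention that `p_{H+1}` is the
point mass at `0`. -/
def nextDist (p : Fin H → CondDist X A lam) (h : Fin H) : Kernel (X × A) ℝ :=
  if hh : (h : ℕ) + 1 < H then (p ⟨h + 1, hh⟩).toKernel else Kernel.const _ (Measure.dirac 0)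

/-- The policy at the step after `h`. At the last step its value plays no role, because the
conditional distribution at the following step does not depend on the action. -/
def Policy.next (π : Policy X A H) (h : Fin H) : Kernel X A :=
  if hh : (h : ℕ) + 1 < H then π.act ⟨h + 1, hh⟩ else π.act h

/-- The law of `((c, x'), Z)` given `(x, a)`, where `c ∼ C_h(x, a)`, `x' ∼ P_h(x, a)`,
`a' ∼ π_{h+1}(x')` and `Z ∼ g(x', a')`. -/
def targetKernel (M : MDP X A H) (π : Policy X A H) (h : Fin H) (g : Kernel (X × A) ℝ) :
    Kernel (X × A) ((ℝ × X) × ℝ) :=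
  M.step h ⊗ₖ (g ∘ₖ withAction (π.next h)).comap (fun w : (X × A) × (ℝ × X) => w.2.2)
    (measurable_snd.comp measurable_snd)

/-- The distributional Bellman operator: `T_h^{D,π} g (x, a)` is the law of `c + g(x', a')`. -/
def distBellman (M : MDP X A H) (π : Policy X A H) (h : Fin H) (g : Kernel (X × A) ℝ) :
    Kernel (X × A) ℝ :=
  (targetKernel M π h g).map (fun w => w.1.1 + w.2)

/-- The class `𝒫 = 𝒫_1 × ⋯ × 𝒫_H` of tuples of conditional distributions. -/
def tuples (P : Fin H → Finset (CondDist X A lam)) : Set (Fin H → CondDist X A lam) :=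
  {p | ∀ h, p h ∈ P h}

/-- `π` is a (deterministic) greedy policy with respect to the means of `p`. -/
def IsGreedy (p : Fin H → CondDist X A lam) (π : Policy X A H) : Prop :=
  ∃ (f : Fin H → X → A) (hf : ∀ h, Measurable (f h)),
    (∀ h, π.act h = Kernel.deterministic (f h) (hf h)) ∧
    ∀ h x a, (p h).mean (x, f h x) ≤ (p h).mean (x, a)

/-- Policy-wise distributional Bellman completeness: `T_h^{D,π} p_{h+1} ∈ 𝒫_h` for all `h`,
`p_{h+1} ∈ 𝒫_{h+1}` and `π ∈ Pi`. -/
def DistBC (M : MDP X A H) (P : Fin H → Finset (CondDist X A lam)) (Pi : Set (Policy X A H)) :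
    Prop :=
  ∀ h, ∀ p ∈ tuples P, ∀ π ∈ Pi, ∃ q ∈ P h, q.toKernel = distBellman M π h (nextDist p h)

/-! ### Offline data and the algorithm -/

/-- A transition `((x, a), (c, x'))`. -/
abbrev Transition (X A : Type*) := (X × A) × (ℝ × X)

/-- An offline dataset: `n` transitions for every step. -/
abbrev Dataset (X A : Type*) (H n : ℕ) := Fin H → Fin n → Transition X A

/-- The draws used in the targets: for the `i`-th transition of step `h`, a conditional
distribution `g` and a policy `π`, a number drawn from `g(x'_{h,i}, π_{h+1}(x'_{h,i}))`. -/
abbrev TargetDraws (X A : Type*) [MeasurableSpace X] [MeasurableSpace A] (H n : ℕ) :=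
  Fin H → Fin n → Kernel (X × A) ℝ → Policy X A H → ℝ

/-- The mle loss `-ln p̂(y)` of a density value `p̂(y)`; it is `+∞` if `p̂(y) = 0`. -/
def mleLoss (density_at_y : ℝ≥0) : EReal := -ENNReal.log (density_at_y : ℝ≥0∞)

/-- The empirical loss `L_h^mle(q, g, D_h, π)`, the sum over the `n` transitions of step `h` of the
mle losses of `q(x_{h,i}, a_{h,i})` at the targets `c_{h,i} + Z`, `Z ∼ g(x'_{h,i}, π_{h+1})`. -/
def empLoss (D : Dataset X A H n) (Z : TargetDraws X A H n) (h : Fin H) (q : CondDist X A lam)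
    (g : Kernel (X × A) ℝ) (π : Policy X A H) : EReal :=
  ∑ i, mleLoss (q.density (D h i).1 ((D h i).2.1 + Z h i g π))

/-- The version space of `π`: all `p ∈ 𝒫` such that for every `h` the loss
`L_h^mle(p_h, p_{h+1}, D_h, π)` exceeds `min_{q ∈ 𝒫_h} L_h^mle(q, p_{h+1}, D_h, π)` by at most
`β`. -/
def versionSpace (P : Fin H → Finset (CondDist X A lam)) (β : ℝ) (D : Dataset X A H n)
    (Z : TargetDraws X A H n) (π : Policy X A H) : Set (Fin H → CondDist X A lam) :=
  {p | p ∈ tuples P ∧ ∀ h, empLoss D Z h (p h) (nextDist p h) π ≤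
    (⨅ q ∈ P h, empLoss D Z h q (nextDist p h) π) + (β : EReal)}

/-- The estimated initial value `p̄_1(x_1, π) = E_{a ∼ π_1(x_1)} p̄_1(x_1, a)`. -/
def initValue [NeZero H] (M : MDP X A H) (p : Fin H → CondDist X A lam) (π : Policy X A H) : ℝ :=
  ∫ a, (p 0).mean (M.init, a) ∂(π.act 0 M.init)

/-- `πhat` is a possible output of pessimistic offline distributional RL: for every policy `π ∈ Pi`
a `pes π` of maximal `p̄_1(x_1, π)` in the version space of `π` is chosen, and `πhat` minimizes the
resulting pessimistic estimate over `Pi`. Ties may be broken in any way. -/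
def IsOutput [NeZero H] (M : MDP X A H) (P : Fin H → Finset (CondDist X A lam))
    (Pi : Set (Policy X A H)) (β : ℝ) (D : Dataset X A H n) (Z : TargetDraws X A H n)
    (πhat : Policy X A H) : Prop :=
  ∃ pes : Policy X A H → Fin H → CondDist X A lam,
    (∀ π ∈ Pi, pes π ∈ versionSpace P β D Z π ∧
      ∀ p ∈ versionSpace P β D Z π, initValue M p π ≤ initValue M (pes π) π) ∧
    πhat ∈ Pi ∧ ∀ π ∈ Pi, initValue M (pes πhat) πhat ≤ initValue M (pes π) π

/-- The sampling assumption: for every step `h` the transitions `(x_{h,i}, a_{h,i}, c_{h,i},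
x'_{h,i})`, `i = 1, …, n`, are i.i.d. with `(x, a) ∼ ν_h`, `c ∼ C_h(x, a)`, `x' ∼ P_h(x, a)`; and
for every `p ∈ 𝒫` and `π ∈ Pi` they remain i.i.d. jointly with the draws
`Z_{h,i} ∼ p_{h+1}(x'_{h,i}, π_{h+1}(x'_{h,i}))` used in the targets. Nothing is assumed about
the joint law of draws that belong to different steps, different `p_{h+1}` or different `π`. -/
def IsSample {Ω : Type*} [MeasurableSpace Ω] (μ : Measure Ω) (M : MDP X A H)
    (ν : Fin H → Measure (X × A)) (P : Fin H → Finset (CondDist X A lam)) (Pi : Set (Policy X A H))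
    (D : Ω → Dataset X A H n) (Z : Ω → TargetDraws X A H n) : Prop :=
  ∀ h, ∀ p ∈ tuples P, ∀ π ∈ Pi,
    iIndepFun
      (fun (i : Fin n) ω => ((D ω h i).1, ((D ω h i).2, Z ω h i (nextDist p h) π))) μ ∧
    ∀ i, HasLaw (fun ω => ((D ω h i).1, ((D ω h i).2, Z ω h i (nextDist p h) π)))
      (ν h ⊗ₘ targetKernel M π h (nextDist p h)) μ

end OfflineDistRL

end

open OfflineDistRL

namespace OfflineDistRL

set_option linter.unusedSectionVars false

variable {X A : Type*} [MeasurableSpace X] [MeasurableSpace A] {H n : ℕ}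
  {lam : Measure ℝ} [SFinite lam]

/-! ### Kernels as integrals -/

/-! Pessimism reduces the regret to one estimate for the comparator. By completeness, each `π` in
the policy class has a tuple `p ∈ 𝒫` that solves the distributional Bellman equations exactly, and
on a good event this tuple survives in the version space of `π`. So the maximal estimate for `π̂`
dominates `V^π̂`, and by the choice of `π̂` it is at most the estimate for `π̃`. It remains to bound
the estimate minus the value for `π̃` (`value_sub_value_le`).

For this, let `ρ_t` be the law of the total cost when `π` is rolled in for `t` steps and the rest is
drawn from `p` (`hybrid`). The mean of `ρ_0` is the estimate and `ρ_H` is the law of the return.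
Passing from `ρ_h` to `ρ_{h+1}` replaces `p_h` by its Bellman target, so Cauchy-Schwarz applied to
`u - v = (√u - √v)(√u + √v)` bounds the change of the expectation of `f` by a Hellinger distance
times the `L²` norms of `f`. With `f = (y - V)²` this bounds the growth of the root second moment
about `V = V^π` along the chain; with `f = y - V` it bounds the drift of the mean. Every deviation
is thereby measured by the standard deviation of the return plus a lower-order term
(`abs_mean_sub_le_of_chain`, `abs_initValue_sub_value_le`).

The Hellinger errors come from likelihood theory. Under the true law of the data, the likelihood
ratio of a candidate to the Bellman target has expectation at most `1`, and its square root has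
expectation at most the `n`-th power of the affinity. Markov's inequality and a union bound then
give the good event (`measure_exists_not_goodAt_le`); the coverage coefficient transfers the errors
from `ν_h` to the visitation measure. -/

instance (M : MDP X A H) (h : Fin H) : IsMarkovKernel (M.step h) := by
  unfold MDP.step; infer_instance

instance (κ : Kernel X A) [IsMarkovKernel κ] : IsMarkovKernel (withAction κ) := by
  unfold withAction; infer_instance

lemma CondDist.measurable_coe_density (p : CondDist X A lam) :
    Measurable (Function.uncurry fun z y => (p.density z y : ℝ≥0∞)) :=
  p.measurable_density.coe_nnreal_ennreal

lemma CondDist.lintegral_toKernel (p : CondDist X A lam) (z : X × A) {f : ℝ → ℝ≥0∞}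
    (hf : Measurable f) :
    ∫⁻ y, f y ∂(p.toKernel z) = ∫⁻ y, (p.density z y : ℝ≥0∞) * f y ∂lam := by
  rw [CondDist.toKernel, Kernel.lintegral_withDensity _ p.measurable_coe_density _ hf]
  simp

instance (p : CondDist X A lam) : IsMarkovKernel p.toKernel := by
  refine ⟨fun z => ⟨?_⟩⟩
  have := p.lintegral_toKernel z (f := fun _ => 1) measurable_const
  simpa [p.lintegral_density z] using this

instance (p : Fin H → CondDist X A lam) (h : Fin H) : IsMarkovKernel (nextDist p h) := by
  unfold nextDist; split_ifs <;> infer_instance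

instance (π : Policy X A H) (h : Fin H) : IsMarkovKernel (π.next h) := by
  unfold Policy.next; split_ifs <;> infer_instance

instance isProbabilityMeasure_rollIn (M : MDP X A H) (π : Policy X A H) (t : ℕ) :
    IsProbabilityMeasure (rollIn M π t) := by
  induction t with
  | zero => unfold rollIn; infer_instance
  | succ t ih =>
    unfold rollIn
    split_ifs with ht
    · exact Measure.isProbabilityMeasure_map (by fun_prop)
    · exact ih

lemma lintegral_withAction (κ : Kernel X A) [IsMarkovKernel κ] (x : X) {f : X × A → ℝ≥0∞}
    (hf : Measurable f) : ∫⁻ z, f z ∂(withAction κ x) = ∫⁻ a, f (x, a) ∂(κ x) := by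
  rw [withAction, Kernel.lintegral_id_prod hf]

lemma lintegral_targetKernel (M : MDP X A H) (π : Policy X A H) (h : Fin H)
    (g : Kernel (X × A) ℝ) [IsMarkovKernel g] (z : X × A) {f : (ℝ × X) × ℝ → ℝ≥0∞}
    (hf : Measurable f) :
    ∫⁻ w, f w ∂(targetKernel M π h g z) =
      ∫⁻ w, ∫⁻ y, f (w, y) ∂((g ∘ₖ withAction (π.next h)) w.2) ∂(M.step h z) := by
  rw [targetKernel, Kernel.lintegral_compProd _ _ _ hf]
  simp

lemma lintegral_distBellman (M : MDP X A H) (π : Policy X A H) (h : Fin H)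
    (g : Kernel (X × A) ℝ) [IsMarkovKernel g] (z : X × A) {f : ℝ → ℝ≥0∞} (hf : Measurable f) :
    ∫⁻ y, f y ∂(distBellman M π h g z) =
      ∫⁻ w, ∫⁻ y, f (w.1 + y) ∂((g ∘ₖ withAction (π.next h)) w.2) ∂(M.step h z) := by
  rw [distBellman, Kernel.lintegral_map _ (by fun_prop) _ hf,
    lintegral_targetKernel _ _ _ _ _ (by fun_prop)]

instance (M : MDP X A H) (π : Policy X A H) (h : Fin H) (g : Kernel (X × A) ℝ)
    [IsMarkovKernel g] : IsMarkovKernel (targetKernel M π h g) := by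
  unfold targetKernel; infer_instance

lemma lintegral_rollIn_succ (M : MDP X A H) (π : Policy X A H) (h : Fin H)
    {f : X × ℝ → ℝ≥0∞} (hf : Measurable f) :
    ∫⁻ w, f w ∂(rollIn M π (h + 1)) =
      ∫⁻ w, ∫⁻ a, ∫⁻ v, f (v.2, w.2 + v.1) ∂(M.step h (w.1, a)) ∂(π.act h w.1)
        ∂(rollIn M π h) := by
  have hh : (h : ℕ) < H := h.2
  rw [rollIn, dif_pos hh, lintegral_map hf (by fun_prop),
    Measure.lintegral_compProd (by fun_prop)]
  refine lintegral_congr fun w => ?_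
  have hm : Measurable fun v : ℝ × X => f (v.2, w.2 + v.1) := by fun_prop
  rw [Kernel.lintegral_comap, Kernel.lintegral_comp _ _ _ hm,
    lintegral_withAction _ _ (Measurable.lintegral_kernel hm)]

/-! ### Hybrid laws -/

/-- The law of the estimated cost-to-go from step `t` on under `π`, given the state. -/
noncomputable def costToGo (p : Fin H → CondDist X A lam) (π : Policy X A H) (t : ℕ) :
    Kernel X ℝ :=
  if ht : t < H then (p ⟨t, ht⟩).toKernel ∘ₖ withAction (π.act ⟨t, ht⟩)
  else Kernel.const _ (Measure.dirac 0)

instance (p : Fin H → CondDist X A lam) (π : Policy X A H) (t : ℕ) :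
    IsMarkovKernel (costToGo p π t) := by
  unfold costToGo; split_ifs <;> infer_instance

/-- At the last step both sides are the point mass at `0`, whatever action the convention in
`Policy.next` supplies. -/
lemma nextDist_comp_next (p : Fin H → CondDist X A lam) (π : Policy X A H) (h : Fin H) :
    nextDist p h ∘ₖ withAction (π.next h) = costToGo p π (h + 1) := by
  unfold nextDist Policy.next costToGo
  split_ifs with hh
  · rfl
  · ext x s hs
    rw [Kernel.comp_apply' _ _ _ hs]
    simp

/-- The law of the total cost when `π` is rolled in for `t` steps and the remaining cost is drawn
from `p`. -/
noncomputable def hybrid (M : MDP X A H) (π : Policy X A H) (p : Fin H → CondDist X A lam)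
    (t : ℕ) : Measure ℝ :=
  (rollIn M π t ⊗ₘ (costToGo p π t).comap Prod.fst measurable_fst).map (fun w => w.1.2 + w.2)

instance (M : MDP X A H) (π : Policy X A H) (p : Fin H → CondDist X A lam) (t : ℕ) :
    IsProbabilityMeasure (hybrid M π p t) :=
  Measure.isProbabilityMeasure_map (by fun_prop)

lemma lintegral_hybrid (M : MDP X A H) (π : Policy X A H) (p : Fin H → CondDist X A lam) (t : ℕ)
    {f : ℝ → ℝ≥0∞} (hf : Measurable f) :
    ∫⁻ y, f y ∂(hybrid M π p t) =
      ∫⁻ w, ∫⁻ y, f (w.2 + y) ∂(costToGo p π t w.1) ∂(rollIn M π t) := by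
  rw [hybrid, lintegral_map hf (by fun_prop), Measure.lintegral_compProd (by fun_prop)]
  simp

lemma lintegral_hybrid_fin (M : MDP X A H) (π : Policy X A H) (p : Fin H → CondDist X A lam)
    (h : Fin H) {f : ℝ → ℝ≥0∞} (hf : Measurable f) :
    ∫⁻ y, f y ∂(hybrid M π p h) =
      ∫⁻ w, ∫⁻ a, ∫⁻ y, f (w.2 + y) ∂((p h).toKernel (w.1, a)) ∂(π.act h w.1)
        ∂(rollIn M π h) := by
  rw [lintegral_hybrid _ _ _ _ hf]
  refine lintegral_congr fun w => ?_
  have hm : Measurable fun y => f (w.2 + y) := by fun_prop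
  rw [costToGo, dif_pos h.2, Kernel.lintegral_comp _ _ _ hm,
    lintegral_withAction _ _ (Measurable.lintegral_kernel hm)]

/-- The cost of step `h` is regrouped with the estimated cost-to-go instead of the accumulated cost.
The result has the shape of `lintegral_hybrid_fin`, with the Bellman target in place of `p h`. -/
lemma lintegral_hybrid_succ (M : MDP X A H) (π : Policy X A H) (p : Fin H → CondDist X A lam)
    (h : Fin H) {f : ℝ → ℝ≥0∞} (hf : Measurable f) :
    ∫⁻ y, f y ∂(hybrid M π p (h + 1)) =
      ∫⁻ w, ∫⁻ a, ∫⁻ y, f (w.2 + y) ∂(distBellman M π h (nextDist p h) (w.1, a)) ∂(π.act h w.1)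
        ∂(rollIn M π h) := by
  have h1 : Measurable fun w : X × ℝ => ∫⁻ y, f (w.2 + y) ∂(costToGo p π (h + 1) w.1) := by
    have : Measurable fun w : (X × ℝ) × ℝ => f (w.1.2 + w.2) := by fun_prop
    exact this.lintegral_kernel_prod_right'
      (κ := (costToGo p π (h + 1)).comap Prod.fst measurable_fst)
  rw [lintegral_hybrid _ _ _ _ hf, lintegral_rollIn_succ _ _ _ h1]
  refine lintegral_congr fun w => lintegral_congr fun a => ?_
  rw [lintegral_distBellman (f := fun y => f (w.2 + y)) _ _ _ _ _ (by fun_prop),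
    nextDist_comp_next]
  simp [add_assoc]

lemma hybrid_last (M : MDP X A H) (π : Policy X A H) (p : Fin H → CondDist X A lam) :
    hybrid M π p H = returnLaw M π := by
  refine Measure.ext_of_lintegral _ fun f hf => ?_
  rw [lintegral_hybrid _ _ _ _ hf, returnLaw, lintegral_map hf measurable_snd]
  simp [costToGo, lintegral_dirac]

lemma hybrid_congr (M : MDP X A H) (π : Policy X A H) {p : Fin H → CondDist X A lam} {h : Fin H}
    (hp : (p h).toKernel = distBellman M π h (nextDist p h)) :
    hybrid M π p h = hybrid M π p (h + 1) := by
  refine Measure.ext_of_lintegral _ fun f hf => ?_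
  rw [lintegral_hybrid_fin _ _ _ _ hf, lintegral_hybrid_succ _ _ _ _ hf, hp]

lemma lintegral_visitation (M : MDP X A H) (π : Policy X A H) (h : Fin H) {f : X × A → ℝ≥0∞}
    (hf : Measurable f) :
    ∫⁻ z, f z ∂(visitation M π h) =
      ∫⁻ w, ∫⁻ a, f (w.1, a) ∂(π.act h w.1) ∂(rollIn M π h) := by
  have : IsProbabilityMeasure ((rollIn M π h).map Prod.fst) :=
    Measure.isProbabilityMeasure_map (by fun_prop)
  rw [visitation, Measure.lintegral_compProd hf, lintegral_map _ measurable_fst]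
  exact hf.lintegral_kernel_prod_right'

instance (M : MDP X A H) (π : Policy X A H) (h : Fin H) :
    IsProbabilityMeasure (visitation M π h) := by
  have : IsProbabilityMeasure ((rollIn M π h).map Prod.fst) :=
    Measure.isProbabilityMeasure_map (by fun_prop)
  unfold visitation; infer_instance

lemma CondDist.ae_mem_Icc (p : CondDist X A lam) (hlam : lam (Set.Icc (0 : ℝ) 1)ᶜ = 0)
    (z : X × A) : ∀ᵐ y ∂(p.toKernel z), y ∈ Set.Icc (0 : ℝ) 1 := by
  rw [CondDist.toKernel, Kernel.withDensity_apply _ p.measurable_coe_density, Kernel.const_apply]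
  exact (withDensity_absolutelyContinuous _ _).ae_le (mem_ae_iff.2 hlam)

lemma costToGo_fin_apply (p : Fin H → CondDist X A lam) (π : Policy X A H) (h : Fin H) (x : X) :
    costToGo p π h x = (π.act h x).bind
      ((p h).toKernel.comap (fun a => (x, a)) measurable_prodMk_left) := by
  refine Measure.ext_of_lintegral _ fun f hf => ?_
  rw [costToGo, dif_pos h.2, Kernel.lintegral_comp _ _ _ hf,
    lintegral_withAction _ _ (Measurable.lintegral_kernel hf),
    Measure.lintegral_bind (Kernel.aemeasurable _) hf.aemeasurable]
  simp

lemma ae_costToGo_mem_Icc (p : Fin H → CondDist X A lam) (π : Policy X A H)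
    (hlam : lam (Set.Icc (0 : ℝ) 1)ᶜ = 0) (t : ℕ) (x : X) :
    ∀ᵐ y ∂(costToGo p π t x), y ∈ Set.Icc (0 : ℝ) 1 := by
  by_cases ht : t < H
  · rw [show t = ((⟨t, ht⟩ : Fin H) : ℕ) from rfl, costToGo_fin_apply]
    refine Measure.ae_comp_of_ae_ae measurableSet_Icc (Filter.Eventually.of_forall fun a => ?_)
    exact (p ⟨t, ht⟩).ae_mem_Icc hlam _
  · rw [costToGo, dif_neg ht, Kernel.const_apply]
    exact (ae_dirac_iff measurableSet_Icc).2 (by simp)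

lemma hybrid_zero (M : MDP X A H) (π : Policy X A H) (p : Fin H → CondDist X A lam) :
    hybrid M π p 0 = costToGo p π 0 M.init := by
  refine Measure.ext_of_lintegral _ fun f hf => ?_
  rw [lintegral_hybrid _ _ _ _ hf, rollIn, lintegral_dirac']
  · simp
  · have : Measurable fun w : (X × ℝ) × ℝ => f (w.1.2 + w.2) := by fun_prop
    exact this.lintegral_kernel_prod_right' (κ := (costToGo p π 0).comap Prod.fst measurable_fst)

lemma initValue_eq_integral_hybrid [NeZero H] (M : MDP X A H) (π : Policy X A H)
    (p : Fin H → CondDist X A lam) (hlam : lam (Set.Icc (0 : ℝ) 1)ᶜ = 0) :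
    initValue M p π = ∫ y, y ∂(hybrid M π p 0) := by
  have hint : Integrable (fun y : ℝ => y) (hybrid M π p 0) := by
    rw [hybrid_zero]
    refine Integrable.of_bound (by fun_prop) 1 ?_
    filter_upwards [ae_costToGo_mem_Icc p π hlam 0 M.init] with y hy
    rw [Real.norm_eq_abs, abs_le]; constructor <;> linarith [hy.1, hy.2]
  have h0 : hybrid M π p 0 =
      (((p 0).toKernel.comap (fun a => (M.init, a)) measurable_prodMk_left) ∘ₖ
        Kernel.const Unit (π.act 0 M.init)) () :=
    ((hybrid_zero M π p).trans (costToGo_fin_apply p π 0 M.init)).trans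
      (by rw [Kernel.comp_apply, Kernel.const_apply])
  rw [h0] at hint ⊢
  rw [Kernel.integral_comp hint]
  simp [initValue, CondDist.mean]

/-! ### Comparing expectations through the Hellinger distance of densities -/

lemma abs_integral_mul_le_sqrt {Y : Type*} [MeasurableSpace Y] {Θ : Measure Y} {a b : Y → ℝ}
    (ha : MemLp a 2 Θ) (hb : MemLp b 2 Θ) :
    |∫ y, a y * b y ∂Θ| ≤ √(∫ y, a y ^ 2 ∂Θ) * √(∫ y, b y ^ 2 ∂Θ) := by
  have h := integral_mul_norm_le_Lp_mul_Lq (μ := Θ) (f := a) (g := b) Real.HolderConjugate.two_two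
    (by simpa using ha) (by simpa using hb)
  simp only [Real.norm_eq_abs, Real.rpow_two, sq_abs, ← Real.sqrt_eq_rpow] at h
  refine (abs_integral_le_integral_abs).trans ?_
  simpa [abs_mul] using h

/-- Cauchy-Schwarz for `(u - v) f = (√u - √v) · f (√u + √v)`: the first factor has squared norm at
most `d`, the second is controlled by the second moments of `f` under `u` and `v`. -/
lemma abs_integral_sub_le_hellinger {Y : Type*} [MeasurableSpace Y] {Θ : Measure Y}
    {u v : Y → ℝ≥0} (hu : Measurable u) (hv : Measurable v)
    (hu1 : ∫⁻ y, (u y : ℝ≥0∞) ∂Θ ≠ ⊤) (hv1 : ∫⁻ y, (v y : ℝ≥0∞) ∂Θ ≠ ⊤)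
    {f : Y → ℝ} (hf : Measurable f) {B : ℝ} (hB : ∀ᵐ y ∂Θ, |f y| ≤ B)
    {d : ℝ} (hd : 0 ≤ d)
    (hdist : ∫⁻ y, ENNReal.ofReal ((√(u y : ℝ) - √(v y : ℝ)) ^ 2) ∂Θ ≤ ENNReal.ofReal d) :
    |∫ y, u y * f y ∂Θ - ∫ y, v y * f y ∂Θ| ≤
      √(2 * d) * (√(∫ y, u y * f y ^ 2 ∂Θ) + √(∫ y, v y * f y ^ 2 ∂Θ)) := by
  have hint : ∀ w : Y → ℝ≥0, Measurable w → ∫⁻ y, (w y : ℝ≥0∞) ∂Θ ≠ ⊤ →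
      Integrable (fun y => (w y : ℝ)) Θ := fun w hw hw1 => by
    refine ⟨by fun_prop, ?_⟩
    rw [hasFiniteIntegral_iff_enorm]
    simpa [lt_top_iff_ne_top] using hw1
  have iu := hint u hu hu1
  have iv := hint v hv hv1
  have hB2 : ∀ᵐ y ∂Θ, ‖f y ^ 2‖ ≤ B ^ 2 := by
    filter_upwards [hB] with y hy
    rw [Real.norm_eq_abs, abs_pow]
    gcongr
  have hB1 : ∀ᵐ y ∂Θ, ‖f y‖ ≤ B := hB
  have iuf := iu.mul_bdd hf.aestronglyMeasurable hB1
  have ivf := iv.mul_bdd hf.aestronglyMeasurable hB1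
  have iuf2 := iu.mul_bdd (hf.pow_const 2).aestronglyMeasurable hB2
  have ivf2 := iv.mul_bdd (hf.pow_const 2).aestronglyMeasurable hB2
  set a : Y → ℝ := fun y => √(u y : ℝ) - √(v y : ℝ) with ha
  set b : Y → ℝ := fun y => f y * (√(u y : ℝ) + √(v y : ℝ)) with hb
  have hsu : ∀ y, √(u y : ℝ) ^ 2 = u y := fun y => Real.sq_sqrt (u y).2
  have hsv : ∀ y, √(v y : ℝ) ^ 2 = v y := fun y => Real.sq_sqrt (v y).2
  have am : Measurable a := by fun_prop
  have bm : Measurable b := by fun_prop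
  have a2 : Integrable (fun y => a y ^ 2) Θ := by
    refine (iu.add iv).mono' (by fun_prop) (Filter.Eventually.of_forall fun y => ?_)
    rw [Real.norm_eq_abs, abs_of_nonneg (sq_nonneg _)]
    simp only [ha, Pi.add_apply]
    nlinarith [hsu y, hsv y, Real.sqrt_nonneg (u y : ℝ), Real.sqrt_nonneg (v y : ℝ),
      mul_nonneg (Real.sqrt_nonneg (u y : ℝ)) (Real.sqrt_nonneg (v y : ℝ))]
  -- Parallelogram identity: `(√u + √v)² + (√u - √v)² = 2u + 2v`.
  have b2le : ∀ y, b y ^ 2 ≤ 2 * (u y * f y ^ 2) + 2 * (v y * f y ^ 2) := fun y => by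
    have h1 : b y ^ 2 + (f y * (√(u y : ℝ) - √(v y : ℝ))) ^ 2 =
        2 * (√(u y : ℝ) ^ 2 * f y ^ 2) + 2 * (√(v y : ℝ) ^ 2 * f y ^ 2) := by
      simp only [hb]; ring
    rw [hsu y, hsv y] at h1
    linarith [sq_nonneg (f y * (√(u y : ℝ) - √(v y : ℝ)))]
  have b2 : Integrable (fun y => b y ^ 2) Θ := by
    refine ((iuf2.const_mul 2).add (ivf2.const_mul 2)).mono' (by fun_prop)
      (Filter.Eventually.of_forall fun y => ?_)
    rw [Real.norm_eq_abs, abs_of_nonneg (sq_nonneg _)]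
    exact b2le y
  have hA : ∫ y, a y ^ 2 ∂Θ ≤ d := by
    rw [integral_eq_lintegral_of_nonneg_ae (Filter.Eventually.of_forall fun y => sq_nonneg _)
      a2.aestronglyMeasurable]
    exact ENNReal.toReal_le_of_le_ofReal hd hdist
  have hP : 0 ≤ ∫ y, u y * f y ^ 2 ∂Θ := integral_nonneg fun y => by positivity
  have hQ : 0 ≤ ∫ y, v y * f y ^ 2 ∂Θ := integral_nonneg fun y => by positivity
  have hBb : ∫ y, b y ^ 2 ∂Θ ≤ 2 * (∫ y, u y * f y ^ 2 ∂Θ + ∫ y, v y * f y ^ 2 ∂Θ) := by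
    rw [mul_add, ← integral_const_mul, ← integral_const_mul, ← integral_add
      (iuf2.const_mul 2) (ivf2.const_mul 2)]
    exact integral_mono b2 ((iuf2.const_mul 2).add (ivf2.const_mul 2)) b2le
  have hab : ∫ y, u y * f y ∂Θ - ∫ y, v y * f y ∂Θ = ∫ y, a y * b y ∂Θ := by
    rw [← integral_sub iuf ivf]
    refine integral_congr_ae (Filter.Eventually.of_forall fun y => ?_)
    have h1 : a y * b y = √(u y : ℝ) ^ 2 * f y - √(v y : ℝ) ^ 2 * f y := by
      simp only [ha, hb]; ring
    rw [hsu y, hsv y] at h1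
    exact h1.symm
  rw [hab]
  calc |∫ y, a y * b y ∂Θ|
      ≤ √(∫ y, a y ^ 2 ∂Θ) * √(∫ y, b y ^ 2 ∂Θ) := abs_integral_mul_le_sqrt
        ((memLp_two_iff_integrable_sq am.aestronglyMeasurable).2 a2)
        ((memLp_two_iff_integrable_sq bm.aestronglyMeasurable).2 b2)
    _ ≤ √d * √(2 * (∫ y, u y * f y ^ 2 ∂Θ + ∫ y, v y * f y ^ 2 ∂Θ)) := by gcongr
    _ = √(2 * d) * √(∫ y, u y * f y ^ 2 ∂Θ + ∫ y, v y * f y ^ 2 ∂Θ) := by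
        rw [← Real.sqrt_mul hd, ← Real.sqrt_mul (by positivity)]
        ring_nf
    _ ≤ _ := by gcongr; exact Real.sqrt_le_iff.2 ⟨by positivity, by
        nlinarith [Real.sq_sqrt hP, Real.sq_sqrt hQ, mul_nonneg (Real.sqrt_nonneg
          (∫ y, u y * f y ^ 2 ∂Θ)) (Real.sqrt_nonneg (∫ y, v y * f y ^ 2 ∂Θ))]⟩

/-- Two laws whose expectations of a continuous `f` differ by at most `η` times their `L²` norms
of `f`. -/
def MeanClose (η : ℝ) (ρ ρ' : Measure ℝ) : Prop :=
  ∀ f : ℝ → ℝ, Continuous f →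
    |∫ y, f y ∂ρ - ∫ y, f y ∂ρ'| ≤ η * (√(∫ y, f y ^ 2 ∂ρ) + √(∫ y, f y ^ 2 ∂ρ'))

lemma sqrt_integral_fourth_le {ρ : Measure ℝ} [IsFiniteMeasure ρ] {V : ℝ}
    (hV : ∀ᵐ y ∂ρ, |y - V| ≤ 2) :
    √(∫ y, ((y - V) ^ 2) ^ 2 ∂ρ) ≤ 2 * √(∫ y, (y - V) ^ 2 ∂ρ) := by
  have h1 : ∫ y, ((y - V) ^ 2) ^ 2 ∂ρ ≤ ∫ y, 4 * (y - V) ^ 2 ∂ρ := by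
    refine integral_mono_of_nonneg (Filter.Eventually.of_forall fun y => sq_nonneg _) ?_ ?_
    · refine Integrable.of_bound (by fun_prop) 16 ?_
      filter_upwards [hV] with y hy
      rw [Real.norm_eq_abs, abs_of_nonneg (by positivity), ← sq_abs (y - V)]
      nlinarith [abs_nonneg (y - V)]
    · filter_upwards [hV] with y hy
      have : (y - V) ^ 2 ≤ 4 := by rw [← sq_abs]; nlinarith [abs_nonneg (y - V)]
      nlinarith [sq_nonneg (y - V)]
  rw [integral_const_mul] at h1
  calc _ ≤ √(2 ^ 2 * ∫ y, (y - V) ^ 2 ∂ρ) := Real.sqrt_le_sqrt (by linarith)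
    _ = _ := by rw [Real.sqrt_mul (by positivity), Real.sqrt_sq (by norm_num)]

/-- Test with `f = (y - V)²`. As `|y - V| ≤ 2`, the `L²` norm of `f` is at most twice the root
second moment, so `s² - s'² ≤ 2η(s + s')`, and the factor `s + s'` cancels. -/
lemma MeanClose.sqrt_second_moment_le {η V : ℝ} (hη : 0 ≤ η) {ρ ρ' : Measure ℝ}
    [IsFiniteMeasure ρ] [IsFiniteMeasure ρ'] (h : MeanClose η ρ ρ')
    (hV : ∀ᵐ y ∂ρ, |y - V| ≤ 2) (hV' : ∀ᵐ y ∂ρ', |y - V| ≤ 2) :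
    √(∫ y, (y - V) ^ 2 ∂ρ) ≤ √(∫ y, (y - V) ^ 2 ∂ρ') + 2 * η := by
  have h1 := h (fun y => (y - V) ^ 2) (by fun_prop)
  have h2 := sqrt_integral_fourth_le hV
  have h3 := sqrt_integral_fourth_le hV'
  have hF : 0 ≤ ∫ y, (y - V) ^ 2 ∂ρ := integral_nonneg fun y => by positivity
  have hF' : 0 ≤ ∫ y, (y - V) ^ 2 ∂ρ' := integral_nonneg fun y => by positivity
  set s := √(∫ y, (y - V) ^ 2 ∂ρ) with hs
  set s' := √(∫ y, (y - V) ^ 2 ∂ρ') with hs'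
  have e : ∫ y, (y - V) ^ 2 ∂ρ = s ^ 2 := (Real.sq_sqrt hF).symm
  have e' : ∫ y, (y - V) ^ 2 ∂ρ' = s' ^ 2 := (Real.sq_sqrt hF').symm
  have hs0 : 0 ≤ s := Real.sqrt_nonneg _
  have hs0' : 0 ≤ s' := Real.sqrt_nonneg _
  have h4 : s ^ 2 - s' ^ 2 ≤ 2 * η * (s + s') := by
    rw [← e, ← e']
    refine (le_abs_self _).trans (h1.trans ?_)
    nlinarith
  by_contra! hc
  nlinarith

/-- Going backwards from `ρ N`, the root second moment about `V` grows by at most `2η` per step, so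
it never exceeds `σ + 2Nη`. Each of the `N` steps then moves the mean by at most `2η(σ + 2Nη)`. -/
lemma abs_mean_sub_le_of_chain {η V : ℝ} (hη : 0 ≤ η) (N : ℕ) (ρ : ℕ → Measure ℝ)
    [∀ t, IsProbabilityMeasure (ρ t)] (hρ : ∀ t < N, MeanClose η (ρ t) (ρ (t + 1)))
    (hV : ∀ t ≤ N, ∀ᵐ y ∂(ρ t), |y - V| ≤ 2) :
    |∫ y, y ∂(ρ 0) - ∫ y, y ∂(ρ N)| ≤
      2 * N * η * √(∫ y, (y - V) ^ 2 ∂(ρ N)) + 4 * N ^ 2 * η ^ 2 := by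
  set σ := √(∫ y, (y - V) ^ 2 ∂(ρ N)) with hσ
  have hs : ∀ k ≤ N, √(∫ y, (y - V) ^ 2 ∂(ρ (N - k))) ≤ σ + 2 * k * η := by
    intro k
    induction k with
    | zero => simp [hσ]
    | succ k ih =>
      intro hk
      have hc := hρ (N - (k + 1)) (by omega)
      rw [show N - (k + 1) + 1 = N - k by omega] at hc
      have := hc.sqrt_second_moment_le hη (hV _ (by omega)) (hV _ (by omega))
      have := ih (by omega)
      push_cast
      linarith
  have hs' : ∀ t ≤ N, √(∫ y, (y - V) ^ 2 ∂(ρ t)) ≤ σ + 2 * N * η := by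
    intro t ht
    have h1 := hs (N - t) (by omega)
    rw [show N - (N - t) = t by omega] at h1
    have : ((N - t : ℕ) : ℝ) * η ≤ N * η := by gcongr; omega
    linarith
  have hint : ∀ t ≤ N, Integrable (fun y : ℝ => y) (ρ t) := fun t ht => by
    refine Integrable.of_bound (by fun_prop) (2 + |V|) ?_
    filter_upwards [hV t ht] with y hy
    calc |y| = |(y - V) + V| := by ring_nf
      _ ≤ _ := (abs_add_le _ _).trans (by gcongr)
  have hstep : ∀ t < N, |∫ y, y ∂(ρ t) - ∫ y, y ∂(ρ (t + 1))| ≤ η * (2 * (σ + 2 * N * η)) := by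
    intro t ht
    -- Centring at `V` leaves the difference of means unchanged and turns the `L²` norms into
    -- deviations from `V`.
    have h1 := hρ t ht (fun y => y - V) (by fun_prop)
    rw [integral_sub (hint t ht.le) (integrable_const _),
      integral_sub (hint (t + 1) ht) (integrable_const _)] at h1
    simp only [integral_const, probReal_univ, one_smul, sub_sub_sub_cancel_right] at h1
    refine h1.trans ?_
    have := hs' t ht.le
    have := hs' (t + 1) ht
    gcongr
    linarith
  have hsum : ∀ k ≤ N, |∫ y, y ∂(ρ 0) - ∫ y, y ∂(ρ k)| ≤ k * (η * (2 * (σ + 2 * N * η))) := by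
    intro k
    induction k with
    | zero => simp
    | succ k ih =>
      intro hk
      have h1 := ih (by omega)
      have h2 := hstep k (by omega)
      push_cast
      calc _ ≤ |∫ y, y ∂(ρ 0) - ∫ y, y ∂(ρ k)| + |∫ y, y ∂(ρ k) - ∫ y, y ∂(ρ (k + 1))| :=
            abs_sub_le _ _ _
        _ ≤ _ := by linarith
  refine (hsum N le_rfl).trans (le_of_eq ?_)
  ring

/-! ### Exact conditional distributions -/

/-- `p` is the family of conditional distributions of the cost-to-go of `π`: a fixed point of the
distributional Bellman operators. -/
def IsExact (M : MDP X A H) (π : Policy X A H) (p : Fin H → CondDist X A lam) : Prop :=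
  ∀ h, (p h).toKernel = distBellman M π h (nextDist p h)

lemma nextDist_update_of_le (p : Fin H → CondDist X A lam) (q : CondDist X A lam) {h k : Fin H}
    (hk : k ≤ h) : nextDist (Function.update p k q) h = nextDist p h := by
  unfold nextDist
  split_ifs with hh
  · rw [Function.update_of_ne]
    intro h1
    rw [← h1, Fin.le_def] at hk
    simp at hk
  · rfl

/-- Solution of a backward recursion in which the component at `h` is determined by the component
at the following step. -/
lemma exists_eq_backward {P : Fin H → Finset (CondDist X A lam)} (hP : ∀ h, (P h).Nonempty)
    (F : Fin H → Kernel (X × A) ℝ → CondDist X A lam)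
    (hF : ∀ h, ∀ p ∈ tuples P, F h (nextDist p h) ∈ P h) :
    ∃ p ∈ tuples P, ∀ h, p h = F h (nextDist p h) := by
  have key : ∀ k ≤ H, ∃ p ∈ tuples P, ∀ h : Fin H, H - k ≤ (h : ℕ) →
      p h = F h (nextDist p h) := by
    intro k
    induction k with
    | zero =>
      intro _
      choose p hp using hP
      exact ⟨p, hp, fun h hh => absurd h.2 (by omega)⟩
    | succ k ih =>
      intro hk
      obtain ⟨p, hp, hpk⟩ := ih (by omega)
      let h0 : Fin H := ⟨H - (k + 1), by omega⟩
      -- The recursion at a step `h ≥ h0` looks only at the component after `h`, so changing the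
      -- component at `h0` preserves the equations already solved.
      refine ⟨Function.update p h0 (F h0 (nextDist p h0)), fun h => ?_, fun h hh => ?_⟩
      · rcases eq_or_ne h h0 with rfl | hne
        · simpa using hF _ p hp
        · simpa [hne] using hp h
      · have hle : h0 ≤ h := hh
        rw [nextDist_update_of_le _ _ hle]
        rcases eq_or_ne h h0 with rfl | hne
        · simp
        · rw [Function.update_of_ne hne]
          refine hpk h ?_
          have : (h0 : ℕ) < h := lt_of_le_of_ne hle fun h' => hne (Fin.ext h'.symm)
          simp only [h0] at this
          omega
  obtain ⟨p, hp, h⟩ := key H le_rfl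
  exact ⟨p, hp, fun h' => h h' (by simp)⟩

lemma IsExact.hybrid_eq {M : MDP X A H} {π : Policy X A H} {p : Fin H → CondDist X A lam}
    (hp : IsExact M π p) {t : ℕ} (ht : t ≤ H) : hybrid M π p t = hybrid M π p 0 := by
  induction t with
  | zero => rfl
  | succ t ih =>
    rw [← ih (by omega)]
    exact (hybrid_congr M π (hp ⟨t, ht⟩)).symm

lemma IsExact.returnLaw_eq {M : MDP X A H} {π : Policy X A H} {p : Fin H → CondDist X A lam}
    (hp : IsExact M π p) : returnLaw M π = hybrid M π p 0 := by
  rw [← hybrid_last M π p, hp.hybrid_eq le_rfl]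

lemma IsExact.initValue_eq [NeZero H] {M : MDP X A H} {π : Policy X A H}
    {p : Fin H → CondDist X A lam} (hp : IsExact M π p)
    (hlam : lam (Set.Icc (0 : ℝ) 1)ᶜ = 0) : initValue M p π = value M π := by
  rw [initValue_eq_integral_hybrid M π p hlam, value, hp.returnLaw_eq]

lemma ae_hybrid_zero_mem_Icc (M : MDP X A H) (π : Policy X A H) (p : Fin H → CondDist X A lam)
    (hlam : lam (Set.Icc (0 : ℝ) 1)ᶜ = 0) :
    ∀ᵐ y ∂(hybrid M π p 0), y ∈ Set.Icc (0 : ℝ) 1 := by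
  rw [hybrid_zero]
  exact ae_costToGo_mem_Icc p π hlam 0 M.init

lemma ae_hybrid_iff (M : MDP X A H) (π : Policy X A H) (p : Fin H → CondDist X A lam) (t : ℕ)
    {s : Set ℝ} (hs : MeasurableSet s) :
    (∀ᵐ y ∂(hybrid M π p t), y ∈ s) ↔
      ∀ᵐ w ∂(rollIn M π t), ∀ᵐ y ∂(costToGo p π t w.1), w.2 + y ∈ s := by
  have hm : Measurable fun w : (X × ℝ) × ℝ => w.1.2 + w.2 := by fun_prop
  rw [hybrid]
  exact (ae_map_iff hm.aemeasurable hs).trans (Measure.ae_compProd_iff (hm hs))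

/-- All hybrids of an exact tuple equal its initial law, which lives on `[0, 1]`. The accumulated
cost is thus the difference of a total and a cost-to-go, both in `[0, 1]`; this keeps every other
hybrid in a bounded range independent of `H`. -/
lemma IsExact.ae_rollIn_mem_Icc {M : MDP X A H} {π : Policy X A H}
    {p : Fin H → CondDist X A lam} (hp : IsExact M π p)
    (hlam : lam (Set.Icc (0 : ℝ) 1)ᶜ = 0) {t : ℕ} (ht : t ≤ H) :
    ∀ᵐ w ∂(rollIn M π t), w.2 ∈ Set.Icc (-1 : ℝ) 1 := by
  have h1 := ae_hybrid_zero_mem_Icc M π p hlam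
  rw [← hp.hybrid_eq ht, ae_hybrid_iff M π p t measurableSet_Icc] at h1
  filter_upwards [h1] with w hw
  obtain ⟨y, hy1, hy2⟩ := (hw.and (ae_costToGo_mem_Icc p π hlam t w.1)).exists
  constructor <;> linarith [hy1.1, hy1.2, hy2.1, hy2.2]

lemma ae_hybrid_mem_Icc {M : MDP X A H} {π : Policy X A H} (p : Fin H → CondDist X A lam)
    (hlam : lam (Set.Icc (0 : ℝ) 1)ᶜ = 0) {t : ℕ}
    (hS : ∀ᵐ w ∂(rollIn M π t), w.2 ∈ Set.Icc (-1 : ℝ) 1) :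
    ∀ᵐ y ∂(hybrid M π p t), y ∈ Set.Icc (-1 : ℝ) 2 := by
  rw [ae_hybrid_iff M π p t measurableSet_Icc]
  filter_upwards [hS] with w hw
  filter_upwards [ae_costToGo_mem_Icc p π hlam t w.1] with y hy
  constructor <;> linarith [hw.1, hw.2, hy.1, hy.2]

/-! ### One step of the simulation lemma -/

/-- The squared Hellinger distance, up to a factor `2`, between `p(x, a)` and `q(x, a)`. -/
noncomputable def hellinger (p q : CondDist X A lam) (z : X × A) : ℝ≥0∞ :=
  ∫⁻ y, ENNReal.ofReal ((√(p.density z y : ℝ) - √(q.density z y : ℝ)) ^ 2) ∂lam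

lemma CondDist.measurable_density_comp {Y : Type*} [MeasurableSpace Y] (p : CondDist X A lam)
    {f : Y → X × A} (hf : Measurable f) {g : Y → ℝ} (hg : Measurable g) :
    Measurable fun y => p.density (f y) (g y) :=
  p.measurable_density.comp (hf.prodMk hg)

lemma measurable_hellinger (p q : CondDist X A lam) : Measurable (hellinger p q) := by
  have hp := p.measurable_density_comp (Y := (X × A) × ℝ) measurable_fst measurable_snd
  have hq := q.measurable_density_comp (Y := (X × A) × ℝ) measurable_fst measurable_snd
  have : Measurable fun w : (X × A) × ℝ =>
      ENNReal.ofReal ((√(p.density w.1 w.2 : ℝ) - √(q.density w.1 w.2 : ℝ)) ^ 2) := by fun_prop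
  exact this.lintegral_prod_right'

/-- The base measure of the densities of the hybrid laws. -/
noncomputable def baseMeasure (M : MDP X A H) (π : Policy X A H) (lam : Measure ℝ) (h : Fin H) :
    Measure (((X × ℝ) × A) × ℝ) :=
  (rollIn M π h ⊗ₘ (π.act h).comap Prod.fst measurable_fst).prod lam

lemma lintegral_baseMeasure (M : MDP X A H) (π : Policy X A H) (h : Fin H)
    {f : ((X × ℝ) × A) × ℝ → ℝ≥0∞} (hf : Measurable f) :
    ∫⁻ w, f w ∂(baseMeasure M π lam h) =
      ∫⁻ w, ∫⁻ a, ∫⁻ y, f ((w, a), y) ∂lam ∂(π.act h w.1) ∂(rollIn M π h) := by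
  rw [baseMeasure, lintegral_prod _ hf.aemeasurable,
    Measure.lintegral_compProd hf.lintegral_prod_right']
  simp

/-- The density of a conditional distribution as a function on the base space. -/
def baseDensity (p : CondDist X A lam) (w : ((X × ℝ) × A) × ℝ) : ℝ≥0 :=
  p.density (w.1.1.1, w.1.2) w.2

lemma measurable_baseDensity (p : CondDist X A lam) : Measurable (baseDensity p) :=
  p.measurable_density_comp (by fun_prop) (by fun_prop)

lemma lintegral_baseDensity_mul (M : MDP X A H) (π : Policy X A H) (h : Fin H)
    (q : CondDist X A lam) {f : ℝ → ℝ≥0∞} (hf : Measurable f) :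
    ∫⁻ w, (baseDensity q w : ℝ≥0∞) * f (w.1.1.2 + w.2) ∂(baseMeasure M π lam h) =
      ∫⁻ w, ∫⁻ a, ∫⁻ y, f (w.2 + y) ∂(q.toKernel (w.1, a)) ∂(π.act h w.1) ∂(rollIn M π h) := by
  have := measurable_baseDensity q
  rw [lintegral_baseMeasure _ _ _ (by fun_prop)]
  refine lintegral_congr fun w => lintegral_congr fun a => ?_
  rw [q.lintegral_toKernel (f := fun y => f (w.2 + y)) _ (by fun_prop)]
  rfl

/-- Consecutive hybrid laws become images, under one map `(x, s, a, y) ↦ s + y`, of measures with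
densities over the same base. The Hellinger bound can be used upstairs, where the densities are
those of the conditional distributions. -/
lemma eq_map_withDensity (M : MDP X A H) (π : Policy X A H) (h : Fin H) (q : CondDist X A lam)
    {ρ : Measure ℝ} (hρ : ∀ f : ℝ → ℝ≥0∞, Measurable f → ∫⁻ y, f y ∂ρ =
      ∫⁻ w, ∫⁻ a, ∫⁻ y, f (w.2 + y) ∂(q.toKernel (w.1, a)) ∂(π.act h w.1) ∂(rollIn M π h)) :
    ρ = ((baseMeasure M π lam h).withDensity fun w => (baseDensity q w : ℝ≥0∞)).map
      (fun w => w.1.1.2 + w.2) := by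
  have hm := measurable_baseDensity q
  refine Measure.ext_of_lintegral _ fun f hf => ?_
  rw [hρ f hf, lintegral_map hf (by fun_prop),
    lintegral_withDensity_eq_lintegral_mul _ (by fun_prop) (by fun_prop),
    ← lintegral_baseDensity_mul M π h q hf]
  rfl

lemma integral_map_withDensity {Y : Type*} [MeasurableSpace Y] {Θ : Measure Y} {u : Y → ℝ≥0}
    (hu : Measurable u) {φ : Y → ℝ} (hφ : Measurable φ) {f : ℝ → ℝ} (hf : Continuous f) :
    ∫ y, f y ∂((Θ.withDensity fun w => (u w : ℝ≥0∞)).map φ) = ∫ w, u w * f (φ w) ∂Θ := by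
  rw [integral_map hφ.aemeasurable hf.aestronglyMeasurable,
    integral_withDensity_eq_integral_smul hu]
  rfl

lemma meanClose_hybrid {M : MDP X A H} {π : Policy X A H} {p : Fin H → CondDist X A lam}
    (hlam : lam (Set.Icc (0 : ℝ) 1)ᶜ = 0) (h : Fin H)
    (hS : ∀ᵐ w ∂(rollIn M π h), w.2 ∈ Set.Icc (-1 : ℝ) 1) {q : CondDist X A lam}
    (hq : q.toKernel = distBellman M π h (nextDist p h)) {d : ℝ} (hd : 0 ≤ d)
    (hdist : ∫⁻ z, hellinger (p h) q z ∂(visitation M π h) ≤ ENNReal.ofReal d) :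
    MeanClose (√(2 * d)) (hybrid M π p h) (hybrid M π p (h + 1)) := by
  have hmp := measurable_baseDensity (p h)
  have hmq := measurable_baseDensity q
  have hmφ : Measurable fun w : ((X × ℝ) × A) × ℝ => w.1.1.2 + w.2 := by fun_prop
  intro f hf
  have e1 := eq_map_withDensity M π h (p h)
    (fun f hf => lintegral_hybrid_fin M π p h hf)
  have e2 := eq_map_withDensity M π h q (ρ := hybrid M π p (h + 1))
    (fun f hf => by rw [lintegral_hybrid_succ M π p h hf, hq])
  have hone : ∀ r : CondDist X A lam,
      ∫⁻ w, (baseDensity r w : ℝ≥0∞) ∂(baseMeasure M π lam h) ≠ ⊤ := fun r => by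
    have := lintegral_baseDensity_mul M π h r (f := fun _ => 1) measurable_const
    simp only [mul_one] at this
    simp [this]
  obtain ⟨B, hB⟩ := (isCompact_Icc (a := (-1 : ℝ)) (b := 2)).exists_bound_of_continuousOn
    hf.continuousOn
  -- Accumulated cost in `[-1, 1]` plus a draw in `[0, 1]` lies in `[-1, 2]`, where the continuous
  -- `f` is bounded.
  have hBae : ∀ᵐ w ∂(baseMeasure M π lam h), |f (w.1.1.2 + w.2)| ≤ B := by
    have hfst : ∀ᵐ w ∂(rollIn M π h ⊗ₘ (π.act h).comap Prod.fst measurable_fst),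
        w.1.2 ∈ Set.Icc (-1 : ℝ) 1 :=
      Measure.ae_compProd_of_ae_fst _ (measurableSet_preimage measurable_snd measurableSet_Icc) hS
    have hsnd : ∀ᵐ y ∂lam, y ∈ Set.Icc (0 : ℝ) 1 := mem_ae_iff.2 hlam
    filter_upwards [Measure.quasiMeasurePreserving_fst.ae hfst,
      Measure.quasiMeasurePreserving_snd.ae hsnd] with w h1 h2
    exact hB _ ⟨by linarith [h1.1, h2.1], by linarith [h1.2, h2.2]⟩
  have hdist' : ∫⁻ w, ENNReal.ofReal ((√(baseDensity (p h) w : ℝ) - √(baseDensity q w : ℝ)) ^ 2)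
      ∂(baseMeasure M π lam h) ≤ ENNReal.ofReal d := by
    rw [lintegral_baseMeasure _ _ _ (by fun_prop)]
    rwa [lintegral_visitation _ _ _ (measurable_hellinger _ _)] at hdist
  have main := abs_integral_sub_le_hellinger hmp hmq (hone _) (hone _)
    (f := fun w => f (w.1.1.2 + w.2)) (by fun_prop) hBae hd hdist'
  have hf2 : Continuous fun y => f y ^ 2 := hf.pow 2
  rw [e1, e2, integral_map_withDensity hmp hmφ hf, integral_map_withDensity hmq hmφ hf,
    integral_map_withDensity hmp hmφ hf2, integral_map_withDensity hmq hmφ hf2]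
  exact main

/-- The error of an estimated initial value in terms of the variance of the return and of the
Bellman errors along the trajectories of the policy. -/
theorem abs_initValue_sub_value_le [NeZero H] {M : MDP X A H} {π : Policy X A H}
    {pstar p : Fin H → CondDist X A lam} (hlam : lam (Set.Icc (0 : ℝ) 1)ᶜ = 0)
    (hpstar : IsExact M π pstar) {q : Fin H → CondDist X A lam}
    (hq : ∀ h, (q h).toKernel = distBellman M π h (nextDist p h)) {d : ℝ} (hd : 0 ≤ d)
    (hdist : ∀ h, ∫⁻ z, hellinger (p h) (q h) z ∂(visitation M π h) ≤ ENNReal.ofReal d) :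
    |initValue M p π - value M π| ≤
      2 * H * √(2 * d) * √(returnVariance M π) + 4 * H ^ 2 * (2 * d) := by
  have hZ : ∀ᵐ y ∂(returnLaw M π), y ∈ Set.Icc (0 : ℝ) 1 := by
    rw [hpstar.returnLaw_eq]
    exact ae_hybrid_zero_mem_Icc M π pstar hlam
  have hprob : IsProbabilityMeasure (returnLaw M π) := by
    rw [hpstar.returnLaw_eq]; infer_instance
  have hV : value M π ∈ Set.Icc (0 : ℝ) 1 := by
    have hint : Integrable (fun y : ℝ => y) (returnLaw M π) := by
      refine Integrable.of_bound (by fun_prop) 1 ?_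
      filter_upwards [hZ] with y hy
      rw [Real.norm_eq_abs, abs_le]; constructor <;> linarith [hy.1, hy.2]
    constructor
    · refine integral_nonneg_of_ae ?_
      filter_upwards [hZ] with y hy using hy.1
    · calc value M π ≤ ∫ _, (1 : ℝ) ∂(returnLaw M π) := by
            refine integral_mono_ae hint (integrable_const _) ?_
            filter_upwards [hZ] with y hy using hy.2
        _ = 1 := by simp
  have key := abs_mean_sub_le_of_chain (V := value M π) (Real.sqrt_nonneg (2 * d)) H
    (hybrid M π p)
    (fun t ht => meanClose_hybrid hlam ⟨t, ht⟩ (hpstar.ae_rollIn_mem_Icc hlam ht.le)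
      (hq ⟨t, ht⟩) hd (hdist ⟨t, ht⟩))
    (fun t ht => by
      filter_upwards [ae_hybrid_mem_Icc p hlam (hpstar.ae_rollIn_mem_Icc hlam ht)] with y hy
      rw [abs_le]
      constructor <;> linarith [hy.1, hy.2, hV.1, hV.2])
  rw [hybrid_last, ← initValue_eq_integral_hybrid M π p hlam, Real.sq_sqrt (by positivity)] at key
  have hvar : returnVariance M π = ∫ y, (y - value M π) ^ 2 ∂(returnLaw M π) := by
    rw [returnVariance, variance_eq_integral (by fun_prop)]
    rfl
  rw [hvar]
  exact key

/-! ### Change of measure -/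

open Classical in
lemma lintegral_visitation_le (M : MDP X A H) (ν : Fin H → Measure (X × A))
    [∀ h, IsProbabilityMeasure (ν h)] {π : Policy X A H} (hC : coverage M ν π ≠ ⊤) (h : Fin H)
    {f : X × A → ℝ≥0∞} (hf : Measurable f) :
    ∫⁻ z, f z ∂(visitation M π h) ≤ coverage M ν π * ∫⁻ z, f z ∂(ν h) := by
  have hle := le_iSup (fun h => if visitation M π h ≪ ν h then
    essSup ((visitation M π h).rnDeriv (ν h)) (ν h) else ⊤) h
  change _ ≤ coverage M ν π at hle
  have hac : visitation M π h ≪ ν h := by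
    by_contra hac
    rw [if_neg hac] at hle
    exact hC (top_le_iff.1 hle)
  rw [if_pos hac] at hle
  calc ∫⁻ z, f z ∂(visitation M π h)
      = ∫⁻ z, (visitation M π h).rnDeriv (ν h) z * f z ∂(ν h) := by
        rw [lintegral_rnDeriv_mul hac hf.aemeasurable]
    _ ≤ ∫⁻ z, coverage M ν π * f z ∂(ν h) := by
        refine lintegral_mono_ae ?_
        filter_upwards [ENNReal.ae_le_essSup ((visitation M π h).rnDeriv (ν h))] with z hz
        gcongr
        exact hz.trans hle
    _ = _ := lintegral_const_mul _ hf

/-! ### Likelihoods -/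

lemma lintegral_prod_of_iIndepFun {Ω W : Type*} [MeasurableSpace Ω] [MeasurableSpace W]
    {μ : Measure Ω} {κ : Measure W} {Y : Fin n → Ω → W} (hY : iIndepFun Y μ)
    (hlaw : ∀ i, HasLaw (Y i) κ μ) {φ : W → ℝ≥0∞} (hφ : Measurable φ) :
    ∫⁻ ω, ∏ i, φ (Y i ω) ∂μ = (∫⁻ w, φ w ∂κ) ^ n := by
  -- `HasLaw` gives only a.e.-measurability, so the product formula is applied to measurable
  -- versions.
  have hae : ∀ i, Y i =ᵐ[μ] (hlaw i).aemeasurable.mk := fun i => (hlaw i).aemeasurable.ae_eq_mk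
  have hind : iIndepFun (fun i ω => φ ((hlaw i).aemeasurable.mk (Y i) ω)) μ :=
    (hY.congr hae).comp (fun _ => φ) (fun _ => hφ)
  have h1 : ∫⁻ ω, ∏ i, φ (Y i ω) ∂μ = ∫⁻ ω, ∏ i, φ ((hlaw i).aemeasurable.mk (Y i) ω) ∂μ := by
    refine lintegral_congr_ae ?_
    filter_upwards [ae_all_iff.2 hae] with ω hω
    exact Finset.prod_congr rfl fun i _ => by rw [hω i]
  rw [h1, lintegral_prod_eq_prod_lintegral_of_indepFun _ _ hind
    (fun i => hφ.comp (hlaw i).aemeasurable.measurable_mk)]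
  have h2 : ∀ i, ∫⁻ ω, φ ((hlaw i).aemeasurable.mk (Y i) ω) ∂μ = ∫⁻ w, φ w ∂κ := fun i => by
    rw [← (hlaw i).lintegral_comp hφ.aemeasurable]
    refine lintegral_congr_ae ?_
    filter_upwards [hae i] with ω hω
    rw [hω]
  simp [h2]

/-- The density of `p(x, a)` at the target `c + Z` of a transition with its draw. -/
def targetDensity (p : CondDist X A lam) (w : (X × A) × ((ℝ × X) × ℝ)) : ℝ≥0 :=
  p.density w.1 (w.2.1.1 + w.2.2)

lemma measurable_targetDensity (p : CondDist X A lam) : Measurable (targetDensity p) :=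
  p.measurable_density_comp (by fun_prop) (by fun_prop)

/-- Given `(x, a)`, the regression target `c + Z` has the Bellman image as its law, hence density
`q`: the model is well specified. -/
lemma lintegral_target {M : MDP X A H} {π : Policy X A H} {h : Fin H} {g : Kernel (X × A) ℝ}
    [IsMarkovKernel g] {q : CondDist X A lam} (hq : q.toKernel = distBellman M π h g)
    (ν : Measure (X × A)) [IsProbabilityMeasure ν] {F : X × A → ℝ → ℝ≥0∞}
    (hF : Measurable (Function.uncurry F)) :
    ∫⁻ w, F w.1 (w.2.1.1 + w.2.2) ∂(ν ⊗ₘ targetKernel M π h g) =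
      ∫⁻ z, ∫⁻ y, (q.density z y : ℝ≥0∞) * F z y ∂lam ∂ν := by
  have hm : Measurable fun w : (X × A) × ((ℝ × X) × ℝ) => F w.1 (w.2.1.1 + w.2.2) :=
    hF.comp (f := fun w : (X × A) × ((ℝ × X) × ℝ) => (w.1, w.2.1.1 + w.2.2)) (by fun_prop)
  rw [Measure.lintegral_compProd hm]
  refine lintegral_congr fun z => ?_
  have hz : Measurable (F z) := hF.comp measurable_prodMk_left
  rw [← q.lintegral_toKernel z hz, hq, distBellman,
    Kernel.lintegral_map _ (by fun_prop) _ hz]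

/-! ### Exponential bounds for likelihood ratios and their square roots. -/

section Concentration

variable {M : MDP X A H} {π : Policy X A H} {h : Fin H} {g : Kernel (X × A) ℝ} [IsMarkovKernel g]
  {p q : CondDist X A lam} {ν : Measure (X × A)} [IsProbabilityMeasure ν]

lemma ae_targetDensity_ne_zero (hq : q.toKernel = distBellman M π h g) :
    ∀ᵐ w ∂(ν ⊗ₘ targetKernel M π h g), targetDensity q w ≠ 0 := by
  classical
  have hqm := q.measurable_density
  have hF : Measurable (Function.uncurry fun z y =>
      if q.density z y = 0 then (1 : ℝ≥0∞) else 0) :=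
    Measurable.ite (hqm (measurableSet_singleton 0)) measurable_const measurable_const
  have h0 := lintegral_target hq ν hF
  have h1 : ∫⁻ z, ∫⁻ y, (q.density z y : ℝ≥0∞) * (if q.density z y = 0 then (1 : ℝ≥0∞) else 0)
      ∂lam ∂ν = 0 := by
    have : ∀ z y, (q.density z y : ℝ≥0∞) * (if q.density z y = 0 then (1 : ℝ≥0∞) else 0) = 0 := by
      intro z y
      split_ifs with hz <;> simp [hz]
    simp [this]
  rw [h1, lintegral_eq_zero_iff] at h0
  · filter_upwards [h0] with w hw hz
    have hz' : q.density w.1 (w.2.1.1 + w.2.2) = 0 := hz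
    simp [hz'] at hw
  · exact hF.comp (f := fun w : (X × A) × ((ℝ × X) × ℝ) => (w.1, w.2.1.1 + w.2.2)) (by fun_prop)

/-- The factor `q` cancels the denominator, leaving the mass of `p` on `{q ≠ 0}`; on `{q = 0}` the
quotient is `0` by convention. This loss of mass is why only an inequality holds. -/
lemma lintegral_ratio_le (hq : q.toKernel = distBellman M π h g) :
    ∫⁻ w, ((targetDensity p w / targetDensity q w : ℝ≥0) : ℝ≥0∞)
      ∂(ν ⊗ₘ targetKernel M π h g) ≤ 1 := by
  have hpm := p.measurable_density
  have hqm := q.measurable_density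
  have hF : Measurable (Function.uncurry fun z y =>
      ((p.density z y / q.density z y : ℝ≥0) : ℝ≥0∞)) :=
    (hpm.div hqm).coe_nnreal_ennreal
  refine (lintegral_target hq ν hF).le.trans ?_
  calc _ ≤ ∫⁻ z, ∫⁻ y, (p.density z y : ℝ≥0∞) ∂lam ∂ν := by
        refine lintegral_mono fun z => lintegral_mono fun y => ?_
        rw [← ENNReal.coe_mul]
        refine ENNReal.coe_le_coe.2 ?_
        rcases eq_or_ne (q.density z y) 0 with h0 | h0
        · simp [h0]
        · exact (mul_div_cancel₀ _ h0).le
    _ = 1 := by simp [p.lintegral_density]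

/-- The Hellinger affinity of `p` and `q` with inputs drawn from `ν`. -/
noncomputable def affinity (ν : Measure (X × A)) (p q : CondDist X A lam) : ℝ≥0∞ :=
  ∫⁻ z, ∫⁻ y, (NNReal.sqrt (p.density z y * q.density z y) : ℝ≥0∞) ∂lam ∂ν

lemma lintegral_sqrt_ratio_le (hq : q.toKernel = distBellman M π h g) :
    ∫⁻ w, (NNReal.sqrt (targetDensity p w / targetDensity q w) : ℝ≥0∞)
      ∂(ν ⊗ₘ targetKernel M π h g) ≤ affinity ν p q := by
  have hpm := p.measurable_density
  have hqm := q.measurable_density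
  have hF : Measurable (Function.uncurry fun z y =>
      (NNReal.sqrt (p.density z y / q.density z y) : ℝ≥0∞)) :=
    (NNReal.continuous_sqrt.measurable.comp (hpm.div hqm)).coe_nnreal_ennreal
  refine (lintegral_target hq ν hF).le.trans ?_
  refine lintegral_mono fun z => lintegral_mono fun y => ?_
  rw [← ENNReal.coe_mul]
  refine ENNReal.coe_le_coe.2 ?_
  rcases eq_or_ne (q.density z y) 0 with h0 | h0
  · simp [h0]
  · refine le_of_eq ?_
    rw [← NNReal.sqrt_mul_self (q.density z y), ← NNReal.sqrt_mul, NNReal.sqrt_mul_self]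
    congr 1
    field_simp

/-- Integrate `(√p - √q)² + 2√(pq) = p + q`. -/
lemma lintegral_hellinger_add_affinity (ν : Measure (X × A)) [IsProbabilityMeasure ν]
    (p q : CondDist X A lam) :
    ∫⁻ z, hellinger p q z ∂ν + 2 * affinity ν p q = 2 := by
  have hp := p.measurable_density
  have hq := q.measurable_density
  have hs : Measurable (Function.uncurry fun z y =>
      (NNReal.sqrt (p.density z y * q.density z y) : ℝ≥0∞)) :=
    (NNReal.continuous_sqrt.measurable.comp (hp.mul hq)).coe_nnreal_ennreal
  have hsi : Measurable fun z =>
      ∫⁻ y, (NNReal.sqrt (p.density z y * q.density z y) : ℝ≥0∞) ∂lam := hs.lintegral_prod_right'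
  rw [affinity, ← lintegral_const_mul _ hsi, ← lintegral_add_left (measurable_hellinger p q)]
  have : ∀ z, hellinger p q z +
      2 * ∫⁻ y, (NNReal.sqrt (p.density z y * q.density z y) : ℝ≥0∞) ∂lam = 2 := by
    intro z
    have hsz : Measurable fun y => (NNReal.sqrt (p.density z y * q.density z y) : ℝ≥0∞) :=
      hs.comp measurable_prodMk_left
    have hpz : Measurable fun y => p.density z y := hp.comp measurable_prodMk_left
    rw [hellinger, ← lintegral_const_mul _ hsz, ← lintegral_add_right _ (hsz.const_mul 2)]
    have e : ∀ y, ENNReal.ofReal ((√(p.density z y : ℝ) - √(q.density z y : ℝ)) ^ 2) +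
        2 * (NNReal.sqrt (p.density z y * q.density z y) : ℝ≥0∞) =
        (p.density z y : ℝ≥0∞) + (q.density z y : ℝ≥0∞) := by
      intro y
      rw [← ENNReal.ofReal_coe_nnreal (p := NNReal.sqrt _), ← ENNReal.ofReal_ofNat 2,
        ← ENNReal.ofReal_mul (by norm_num), ← ENNReal.ofReal_add (by positivity) (by positivity),
        ← ENNReal.ofReal_coe_nnreal (p := p.density z y),
        ← ENNReal.ofReal_coe_nnreal (p := q.density z y), ← ENNReal.ofReal_add (by simp) (by simp)]
      congr 1
      rw [Real.coe_sqrt, NNReal.coe_mul, Real.sqrt_mul (by simp)]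
      have h1 := Real.sq_sqrt (NNReal.coe_nonneg (p.density z y))
      have h2 := Real.sq_sqrt (NNReal.coe_nonneg (q.density z y))
      change (√(p.density z y : ℝ) - √(q.density z y : ℝ)) ^ 2 +
        2 * (√(p.density z y : ℝ) * √(q.density z y : ℝ)) = _
      linear_combination h1 + h2
    simp_rw [e]
    rw [lintegral_add_left (by fun_prop), p.lintegral_density, q.lintegral_density]
    norm_num
  simp [this]

/-- The affinity is `1 - d/2 ≤ exp(-d/2)`, where `d > 5β/n` is the Hellinger error. -/
lemma affinity_pow_le {β : ℝ} (hn : 0 < n)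
    (hd : ¬ ∫⁻ z, hellinger p q z ∂ν ≤ ENNReal.ofReal (5 * β / n)) :
    affinity ν p q ^ n ≤ ENNReal.ofReal (Real.exp (-(5 * β / 2))) := by
  have h2 := lintegral_hellinger_add_affinity ν p q
  have hb : affinity ν p q ≠ ⊤ := by
    intro ht
    simp [ht] at h2
  have hd' : ∫⁻ z, hellinger p q z ∂ν ≠ ⊤ := by
    intro ht
    simp [ht] at h2
  have hn' : (0 : ℝ) < n := by exact_mod_cast hn
  set b := (affinity ν p q).toReal
  have h3 : (∫⁻ z, hellinger p q z ∂ν).toReal + 2 * b = 2 := by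
    have := congrArg ENNReal.toReal h2
    rwa [ENNReal.toReal_add hd' (ENNReal.mul_ne_top (by simp) hb), ENNReal.toReal_mul] at this
  have h4 : 5 * β / n < (∫⁻ z, hellinger p q z ∂ν).toReal := by
    rw [not_le] at hd
    by_contra! hc
    exact hd.not_ge ((ENNReal.ofReal_toReal hd').symm.le.trans (ENNReal.ofReal_le_ofReal hc))
  have h5 : b ≤ Real.exp (-(5 * β / (2 * n))) := by
    have h6 := Real.add_one_le_exp (-(5 * β / (2 * n)))
    have h7 : 5 * β / (2 * n) = (5 * β / n) / 2 := by field_simp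
    linarith
  have hb0 : 0 ≤ b := ENNReal.toReal_nonneg
  rw [← ENNReal.ofReal_toReal hb, ← ENNReal.ofReal_pow hb0]
  refine ENNReal.ofReal_le_ofReal ((pow_le_pow_left₀ hb0 h5 n).trans (le_of_eq ?_))
  rw [← Real.exp_nat_mul]
  congr 1
  field_simp

variable {Ω : Type*} [MeasurableSpace Ω] {μ : Measure Ω}
  {Y : Fin n → Ω → (X × A) × ((ℝ × X) × ℝ)}

/-- The likelihood of `p` on a sample. -/
def likelihood (p : CondDist X A lam) (y : Fin n → (X × A) × ((ℝ × X) × ℝ)) : ℝ≥0 :=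
  ∏ i, targetDensity p (y i)

lemma ae_targetDensity_sample_ne_zero (hq : q.toKernel = distBellman M π h g)
    (hlaw : ∀ i, HasLaw (Y i) (ν ⊗ₘ targetKernel M π h g) μ) :
    ∀ᵐ ω ∂μ, ∀ i, targetDensity q (Y i ω) ≠ 0 := by
  refine ae_all_iff.2 fun i => ?_
  have := ae_targetDensity_ne_zero (ν := ν) hq
  rw [← (hlaw i).map_eq] at this
  exact ae_of_ae_map (hlaw i).aemeasurable this

lemma aemeasurable_prod_sample (hlaw : ∀ i, HasLaw (Y i) (ν ⊗ₘ targetKernel M π h g) μ)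
    {φ : (X × A) × ((ℝ × X) × ℝ) → ℝ≥0∞} (hφ : Measurable φ) :
    AEMeasurable (fun ω => ∏ i, φ (Y i ω)) μ :=
  Finset.aemeasurable_fun_prod _ fun i _ => hφ.comp_aemeasurable (hlaw i).aemeasurable

lemma measure_likelihood_gt_le (hq : q.toKernel = distBellman M π h g)
    (hY : iIndepFun Y μ) (hlaw : ∀ i, HasLaw (Y i) (ν ⊗ₘ targetKernel M π h g) μ) (β : ℝ) :
    μ {ω | ¬ (likelihood p (fun i => Y i ω) : ℝ) ≤
      Real.exp β * likelihood q (fun i => Y i ω)} ≤ ENNReal.ofReal (Real.exp (-β)) := by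
  set φ : (X × A) × ((ℝ × X) × ℝ) → ℝ≥0∞ := fun w =>
    ((targetDensity p w / targetDensity q w : ℝ≥0) : ℝ≥0∞)
  have hφ : Measurable φ :=
    ((measurable_targetDensity p).div (measurable_targetDensity q)).coe_nnreal_ennreal
  have hE : ∫⁻ ω, ∏ i, φ (Y i ω) ∂μ ≤ 1 := by
    rw [lintegral_prod_of_iIndepFun hY hlaw hφ]
    exact pow_le_one₀ zero_le (lintegral_ratio_le hq)
  calc _ ≤ μ {ω | ENNReal.ofReal (Real.exp β) ≤ ∏ i, φ (Y i ω)} := by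
        refine measure_mono_ae ?_
        filter_upwards [ae_targetDensity_sample_ne_zero hq hlaw] with ω hω hlt
        have hlt' := not_le.1 hlt
        change ENNReal.ofReal (Real.exp β) ≤ ∏ i, φ (Y i ω)
        -- Almost surely no sample point falls where `q` vanishes, so dividing by the likelihood of
        -- `q` is legitimate.
        have hpos : (0 : ℝ) < likelihood q (fun i => Y i ω) := by
          rw [NNReal.coe_pos]
          exact Finset.prod_pos fun i _ => pos_iff_ne_zero.2 (hω i)
        have e : ∏ i, φ (Y i ω) = ENNReal.ofReal
            ((likelihood p (fun i => Y i ω) : ℝ) / likelihood q (fun i => Y i ω)) := by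
          rw [← NNReal.coe_div, ENNReal.ofReal_coe_nnreal, likelihood, likelihood,
            ← Finset.prod_div_distrib, ENNReal.ofNNReal_finsetProd]
        rw [e]
        exact ENNReal.ofReal_le_ofReal ((le_div_iff₀ hpos).2 hlt'.le)
    _ ≤ (∫⁻ ω, ∏ i, φ (Y i ω) ∂μ) / ENNReal.ofReal (Real.exp β) :=
        meas_ge_le_lintegral_div (aemeasurable_prod_sample hlaw hφ)
          (by simp [Real.exp_pos]) ENNReal.ofReal_ne_top
    _ ≤ 1 / ENNReal.ofReal (Real.exp β) := by gcongr
    _ = _ := by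
        rw [one_div, ← ENNReal.ofReal_inv_of_pos (Real.exp_pos _), Real.exp_neg]

/-- If the Hellinger error is small there is nothing to prove. Otherwise a competitive likelihood
forces `∏ √(p/q) ≥ exp(-β/2)`, while the expectation is at most `exp(-5β/2)`. The constant `5` makes
the failure probability `exp(-2β)`, of smaller order than `exp(-β)`, which the union bound needs. -/
lemma measure_hellinger_gt_le (hq : q.toKernel = distBellman M π h g)
    (hY : iIndepFun Y μ) (hlaw : ∀ i, HasLaw (Y i) (ν ⊗ₘ targetKernel M π h g) μ) (hn : 0 < n)
    (β : ℝ) :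
    μ {ω | ¬ ((likelihood q (fun i => Y i ω) : ℝ) ≤
        Real.exp β * likelihood p (fun i => Y i ω) →
      ∫⁻ z, hellinger p q z ∂ν ≤ ENNReal.ofReal (5 * β / n))} ≤
      ENNReal.ofReal (Real.exp (-(2 * β))) := by
  by_cases hd : ∫⁻ z, hellinger p q z ∂ν ≤ ENNReal.ofReal (5 * β / n)
  · simp [hd]
  set φ : (X × A) × ((ℝ × X) × ℝ) → ℝ≥0∞ := fun w =>
    (NNReal.sqrt (targetDensity p w / targetDensity q w) : ℝ≥0∞) with hφdef
  have hφ : Measurable φ := (NNReal.continuous_sqrt.measurable.comp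
    ((measurable_targetDensity p).div (measurable_targetDensity q))).coe_nnreal_ennreal
  have hE : ∫⁻ ω, ∏ i, φ (Y i ω) ∂μ ≤ ENNReal.ofReal (Real.exp (-(5 * β / 2))) := by
    rw [lintegral_prod_of_iIndepFun hY hlaw hφ]
    exact (pow_le_pow_left' (lintegral_sqrt_ratio_le hq) n).trans (affinity_pow_le hn hd)
  calc _ ≤ μ {ω | ENNReal.ofReal (Real.exp (-(β / 2))) ≤ ∏ i, φ (Y i ω)} := by
        refine measure_mono_ae ?_
        filter_upwards [ae_targetDensity_sample_ne_zero hq hlaw] with ω hω hlt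
        have hlt' := (Classical.not_imp.1 hlt).1
        change ENNReal.ofReal (Real.exp (-(β / 2))) ≤ ∏ i, φ (Y i ω)
        have hpos : (0 : ℝ) < likelihood q (fun i => Y i ω) := by
          rw [NNReal.coe_pos]
          exact Finset.prod_pos fun i _ => pos_iff_ne_zero.2 (hω i)
        have e : ∏ i, φ (Y i ω) = ENNReal.ofReal
            (√((likelihood p (fun i => Y i ω) : ℝ) / likelihood q (fun i => Y i ω))) := by
          rw [← NNReal.coe_div, ← Real.coe_sqrt, ENNReal.ofReal_coe_nnreal, likelihood,
            likelihood, ← Finset.prod_div_distrib]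
          simp only [hφdef]
          rw [← ENNReal.ofNNReal_finsetProd]
          exact congrArg _ (map_prod NNReal.sqrtHom _ _).symm
        rw [e]
        refine ENNReal.ofReal_le_ofReal (Real.le_sqrt_of_sq_le ?_)
        rw [← Real.exp_nat_mul, le_div_iff₀ hpos]
        calc _ ≤ Real.exp (((2 : ℕ) : ℝ) * -(β / 2)) *
              (Real.exp β * likelihood p (fun i => Y i ω)) := by gcongr
          _ = _ := by
              rw [← mul_assoc, ← Real.exp_add]
              norm_num
              ring_nf
              simp
    _ ≤ (∫⁻ ω, ∏ i, φ (Y i ω) ∂μ) / ENNReal.ofReal (Real.exp (-(β / 2))) :=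
        meas_ge_le_lintegral_div (aemeasurable_prod_sample hlaw hφ)
          (by simp [Real.exp_pos]) ENNReal.ofReal_ne_top
    _ ≤ ENNReal.ofReal (Real.exp (-(5 * β / 2))) / ENNReal.ofReal (Real.exp (-(β / 2))) := by
        gcongr
    _ = _ := by
        rw [← ENNReal.ofReal_div_of_pos (Real.exp_pos _), ← Real.exp_sub]
        ring_nf

end Concentration

/-! ### Empirical losses -/

lemma mleLoss_mul (a b : ℝ≥0) : mleLoss (a * b) = mleLoss a + mleLoss b := by
  unfold mleLoss
  rw [ENNReal.coe_mul, ENNReal.log_mul_add, EReal.neg_add, sub_eq_add_neg]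
  · right; simp
  · left; simp

lemma empLoss_eq (D : Dataset X A H n) (Z : TargetDraws X A H n) (h : Fin H)
    (q : CondDist X A lam) (g : Kernel (X × A) ℝ) (π : Policy X A H) :
    empLoss D Z h q g π =
      mleLoss (likelihood q fun i => ((D h i).1, ((D h i).2, Z h i g π))) := by
  unfold empLoss likelihood targetDensity
  have : ∀ (s : Finset (Fin n)) (f : Fin n → ℝ≥0),
      ∑ i ∈ s, mleLoss (f i) = mleLoss (∏ i ∈ s, f i) := by
    intro s f
    classical
    induction s using Finset.induction_on with
    | empty => simp [mleLoss]
    | insert a s ha ih => rw [Finset.sum_insert ha, Finset.prod_insert ha, mleLoss_mul, ih]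
  exact this _ _

/-- The likelihood form covers infinite losses as well: both sides hold for `b = 0`, and both fail
for `a = 0 ≠ b`. -/
lemma mleLoss_le_add_iff (a b : ℝ≥0) (β : ℝ) :
    mleLoss a ≤ mleLoss b + (β : EReal) ↔ (b : ℝ) ≤ Real.exp β * a := by
  rcases eq_or_ne b 0 with rfl | hb
  · simp [mleLoss]; positivity
  rcases eq_or_ne a 0 with rfl | ha
  · simp only [mleLoss, ENNReal.coe_zero, ENNReal.log_zero, EReal.neg_bot, top_le_iff,
      NNReal.coe_zero, mul_zero, ENNReal.log_of_nnreal hb]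
    rw [← EReal.coe_neg, ← EReal.coe_add]
    have hb' : (0 : ℝ) < b := NNReal.coe_pos.2 (pos_iff_ne_zero.2 hb)
    exact iff_of_false (EReal.coe_ne_top _) hb'.not_ge
  have ha' : (0 : ℝ) < a := NNReal.coe_pos.2 (pos_iff_ne_zero.2 ha)
  have hb' : (0 : ℝ) < b := NNReal.coe_pos.2 (pos_iff_ne_zero.2 hb)
  rw [mleLoss, mleLoss, ENNReal.log_of_nnreal ha, ENNReal.log_of_nnreal hb, ← EReal.coe_neg,
    ← EReal.coe_neg, ← EReal.coe_add, EReal.coe_le_coe_iff,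
    ← Real.log_le_log_iff hb' (by positivity), Real.log_mul (Real.exp_pos _).ne' ha'.ne',
    Real.log_exp]
  constructor <;> intro h <;> linarith

/-! ### The version spaces on a good event -/

/-- The transitions of step `h` together with the draws for `g` and `π`. -/
def sample (D : Dataset X A H n) (Z : TargetDraws X A H n) (h : Fin H) (g : Kernel (X × A) ℝ)
    (π : Policy X A H) (i : Fin n) : (X × A) × ((ℝ × X) × ℝ) :=
  ((D h i).1, ((D h i).2, Z h i g π))

lemma empLoss_le_add_iff (D : Dataset X A H n) (Z : TargetDraws X A H n) (h : Fin H)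
    (p q : CondDist X A lam) (g : Kernel (X × A) ℝ) (π : Policy X A H) (β : ℝ) :
    empLoss D Z h p g π ≤ empLoss D Z h q g π + (β : EReal) ↔
      (likelihood q (sample D Z h g π) : ℝ) ≤ Real.exp β * likelihood p (sample D Z h g π) := by
  rw [empLoss_eq, empLoss_eq, mleLoss_le_add_iff]
  rfl

lemma le_iInf_empLoss_add_iff (P : Finset (CondDist X A lam)) (D : Dataset X A H n)
    (Z : TargetDraws X A H n) (h : Fin H) (p : CondDist X A lam) (g : Kernel (X × A) ℝ)
    (π : Policy X A H) (β : ℝ) :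
    empLoss D Z h p g π ≤ (⨅ q ∈ P, empLoss D Z h q g π) + (β : EReal) ↔
      ∀ q ∈ P, empLoss D Z h p g π ≤ empLoss D Z h q g π + (β : EReal) := by
  have e : ∀ x : EReal, empLoss D Z h p g π ≤ x + (β : EReal) ↔
      empLoss D Z h p g π - (β : EReal) ≤ x := fun x =>
    (EReal.sub_le_iff_le_add (Or.inl (EReal.coe_ne_bot _)) (Or.inl (EReal.coe_ne_top _))).symm
  simp only [e, le_iInf_iff]

/-- For every Bellman target `q = T g`, chosen by `qs`, the likelihood of no candidate exceeds that
of `q` by much, and candidates whose likelihood is comparable to that of `q` are close to `q`. -/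
def GoodAt (ν : Fin H → Measure (X × A)) (β : ℝ)
    (qs : Fin H → Kernel (X × A) ℝ → Policy X A H → CondDist X A lam) (D : Dataset X A H n)
    (Z : TargetDraws X A H n) (h : Fin H) (p : Fin H → CondDist X A lam) (π : Policy X A H) :
    Prop :=
  (likelihood (p h) (sample D Z h (nextDist p h) π) : ℝ) ≤
      Real.exp β * likelihood (qs h (nextDist p h) π) (sample D Z h (nextDist p h) π) ∧
    ((likelihood (qs h (nextDist p h) π) (sample D Z h (nextDist p h) π) : ℝ) ≤
        Real.exp β * likelihood (p h) (sample D Z h (nextDist p h) π) →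
      ∫⁻ z, hellinger (p h) (qs h (nextDist p h) π) z ∂(ν h) ≤ ENNReal.ofReal (5 * β / n))

lemma tuples_finite (P : Fin H → Finset (CondDist X A lam)) : (tuples P).Finite := by
  refine (Fintype.piFinset P).finite_toSet.subset fun p hp => ?_
  exact Finset.mem_coe.2 (Fintype.mem_piFinset.2 hp)

/-! ### Pessimism and regret on the good event. -/

section Deterministic

variable [NeZero H] {M : MDP X A H} {P : Fin H → Finset (CondDist X A lam)}
  {Pi : Set (Policy X A H)} {ν : Fin H → Measure (X × A)} {β : ℝ}
  {qs : Fin H → Kernel (X × A) ℝ → Policy X A H → CondDist X A lam} {D : Dataset X A H n}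
  {Z : TargetDraws X A H n}

lemma update_mem_tuples {p : Fin H → CondDist X A lam} (hp : p ∈ tuples P) {h : Fin H}
    {r : CondDist X A lam} (hr : r ∈ P h) : Function.update p h r ∈ tuples P := by
  intro k
  rcases eq_or_ne k h with rfl | hne
  · simpa using hr
  · simpa [hne] using hp k

lemma exists_isExact_mem_versionSpace (hP : ∀ h, (P h).Nonempty) {π : Policy X A H}
    (hqs : ∀ h, ∀ p ∈ tuples P, qs h (nextDist p h) π ∈ P h ∧
      (qs h (nextDist p h) π).toKernel = distBellman M π h (nextDist p h))
    (hgood : ∀ h, ∀ p ∈ tuples P, GoodAt ν β qs D Z h p π) :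
    ∃ p ∈ versionSpace P β D Z π, IsExact M π p := by
  obtain ⟨p, hp, hpe⟩ := exists_eq_backward hP (fun h g => qs h g π) (fun h p hp => (hqs h p hp).1)
  refine ⟨p, ⟨hp, fun h => ?_⟩, fun h => ?_⟩
  · rw [le_iInf_empLoss_add_iff]
    intro r hr
    rw [empLoss_le_add_iff]
    -- Any competitor `r` at step `h` is the `h`-th component of a tuple with the same next
    -- distribution, so the first half of the good event compares `r` with the Bellman target `p h`.
    have h1 := (hgood h _ (update_mem_tuples hp hr)).1
    rw [nextDist_update_of_le _ _ le_rfl, ← hpe h] at h1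
    simpa using h1
  · rw [← (hqs h p hp).2, ← hpe h]

lemma exists_isOutput (hPi : Pi.Finite) (hPi' : Pi.Nonempty)
    (hne : ∀ π ∈ Pi, (versionSpace P β D Z π).Nonempty) :
    ∃ πhat, IsOutput M P Pi β D Z πhat := by
  have h1 : ∀ π, ∃ p, π ∈ Pi → p ∈ versionSpace P β D Z π ∧
      ∀ p' ∈ versionSpace P β D Z π, initValue M p' π ≤ initValue M p π := by
    intro π
    by_cases hπ : π ∈ Pi
    · obtain ⟨p, hp, hmax⟩ := Set.exists_max_image (versionSpace P β D Z π)
        (fun p => initValue M p π) ((tuples_finite P).subset fun p hp => hp.1) (hne π hπ)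
      exact ⟨p, fun _ => ⟨hp, hmax⟩⟩
    · obtain ⟨π', hπ'⟩ := hPi'
      obtain ⟨p, -⟩ := hne π' hπ'
      exact ⟨p, fun h => absurd h hπ⟩
  choose pes hpes using h1
  obtain ⟨πhat, hmem, hmin⟩ := Set.exists_min_image Pi (fun π => initValue M (pes π) π) hPi hPi'
  exact ⟨πhat, pes, hpes, hmem, hmin⟩

/-- Optimism of the estimate for `πhat` needs only that an exact tuple lies in its version space, so
coverage is required for `πtilde` alone. For `πtilde`, membership of `pes πtilde` in the version
space makes it competitive with its Bellman targets, hence Hellinger-close to them under `ν`. -/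
lemma value_sub_value_le [∀ h, IsProbabilityMeasure (ν h)]
    (hlam : lam (Set.Icc (0 : ℝ) 1)ᶜ = 0) (hP : ∀ h, (P h).Nonempty) (hβ : 0 ≤ β)
    (hqs : ∀ h, ∀ p ∈ tuples P, ∀ π ∈ Pi, qs h (nextDist p h) π ∈ P h ∧
      (qs h (nextDist p h) π).toKernel = distBellman M π h (nextDist p h))
    (hgood : ∀ h, ∀ p ∈ tuples P, ∀ π ∈ Pi, GoodAt ν β qs D Z h p π)
    {πhat πtilde : Policy X A H} (hout : IsOutput M P Pi β D Z πhat) (htilde : πtilde ∈ Pi)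
    (hC : coverage M ν πtilde ≠ ⊤) :
    value M πhat - value M πtilde ≤
      2 * H * √(10 * ((coverage M ν πtilde).toReal * β / n)) * √(returnVariance M πtilde) +
        4 * H ^ 2 * (10 * ((coverage M ν πtilde).toReal * β / n)) := by
  obtain ⟨pes, hpes, hhat, hmin⟩ := hout
  obtain ⟨phat, hphat, hphat'⟩ := exists_isExact_mem_versionSpace (M := M) hP
    (fun h p hp => hqs h p hp πhat hhat) (fun h p hp => hgood h p hp πhat hhat)
  obtain ⟨pstar, hpstar, hpstar'⟩ := exists_isExact_mem_versionSpace (M := M) hP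
    (fun h p hp => hqs h p hp πtilde htilde) (fun h p hp => hgood h p hp πtilde htilde)
  have h1 : value M πhat ≤ initValue M (pes πtilde) πtilde := by
    rw [← hphat'.initValue_eq hlam]
    exact ((hpes πhat hhat).2 phat hphat).trans (hmin πtilde htilde)
  obtain ⟨hpt, hpv⟩ := (hpes πtilde htilde).1
  have hdist : ∀ h, ∫⁻ z, hellinger (pes πtilde h) (qs h (nextDist (pes πtilde) h) πtilde) z
      ∂(visitation M πtilde h) ≤
      ENNReal.ofReal (5 * ((coverage M ν πtilde).toReal * β / n)) := fun h => by
    have h2 := (le_iInf_empLoss_add_iff _ _ _ _ _ _ _ _).1 (hpv h) _ (hqs h _ hpt _ htilde).1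
    have h3 := (hgood h _ hpt _ htilde).2 ((empLoss_le_add_iff _ _ _ _ _ _ _ _).1 h2)
    refine (lintegral_visitation_le M ν hC h (measurable_hellinger _ _)).trans ?_
    calc _ ≤ coverage M ν πtilde * ENNReal.ofReal (5 * β / n) := by gcongr
      _ = _ := by
        conv_lhs => rw [← ENNReal.ofReal_toReal hC, ← ENNReal.ofReal_mul ENNReal.toReal_nonneg]
        congr 1
        ring
  have h4 := abs_initValue_sub_value_le hlam hpstar' (fun h => (hqs h _ hpt _ htilde).2)
    (by positivity) hdist
  rw [show 2 * (5 * ((coverage M ν πtilde).toReal * β / n)) =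
    10 * ((coverage M ν πtilde).toReal * β / n) by ring] at h4
  linarith [le_abs_self (initValue M (pes πtilde) πtilde - value M πtilde)]

end Deterministic

/-! ### Probability of the good event -/

lemma not_goodAt_measure_le {Ω : Type*} [MeasurableSpace Ω] {μ : Measure Ω}
    {M : MDP X A H} {ν : Fin H → Measure (X × A)}
    [∀ h, IsProbabilityMeasure (ν h)] {P : Fin H → Finset (CondDist X A lam)}
    {Pi : Set (Policy X A H)} {D : Ω → Dataset X A H n} {Z : Ω → TargetDraws X A H n}
    (hn : 0 < n) (hs : IsSample μ M ν P Pi D Z)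
    {qs : Fin H → Kernel (X × A) ℝ → Policy X A H → CondDist X A lam} (β : ℝ) {h : Fin H}
    {p : Fin H → CondDist X A lam} (hp : p ∈ tuples P) {π : Policy X A H} (hπ : π ∈ Pi)
    (hq : (qs h (nextDist p h) π).toKernel = distBellman M π h (nextDist p h)) :
    μ {ω | ¬ GoodAt ν β qs (D ω) (Z ω) h p π} ≤
      ENNReal.ofReal (Real.exp (-β) + Real.exp (-(2 * β))) := by
  obtain ⟨hind, hlaw⟩ := hs h p hp π hπ
  rw [ENNReal.ofReal_add (Real.exp_pos _).le (Real.exp_pos _).le]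
  refine le_trans ?_ (add_le_add (measure_likelihood_gt_le (p := p h) hq hind hlaw β)
    (measure_hellinger_gt_le (p := p h) hq hind hlaw hn β))
  refine le_trans (measure_mono ?_) (measure_union_le _ _)
  intro ω hω
  by_contra hc
  simp only [Set.mem_union, not_or] at hc
  exact hω ⟨not_not.1 hc.1, not_not.1 hc.2⟩

lemma goodAt_of_eq {ν : Fin H → Measure (X × A)} {β : ℝ} (hβ : 0 ≤ β)
    {qs : Fin H → Kernel (X × A) ℝ → Policy X A H → CondDist X A lam} {D : Dataset X A H n}
    {Z : TargetDraws X A H n} {h : Fin H} {p : Fin H → CondDist X A lam} {π : Policy X A H}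
    (hp : p h = qs h (nextDist p h) π) : GoodAt ν β qs D Z h p π := by
  unfold GoodAt
  rw [← hp]
  refine ⟨le_mul_of_one_le_left (by simp) (Real.one_le_exp hβ), fun _ => ?_⟩
  simp [hellinger]

/-- With `x = δ/(H'm)` the exponentials are `x²` and `x⁴`, and `H'mx = δ`, so the claim is `(m -
1)(x + x³) ≤ 1`. Since `mx ≤ 1`, the left side is at most `(1 - x)(1 + x²) ≤ 1`. With `m` in place
of `m - 1` it could fail when `mx` is close to `1`. -/
lemma union_bound_le {H' m δ β : ℝ} (hH : 1 ≤ H') (hm : 1 ≤ m) (hδ : 0 < δ) (hδ1 : δ < 1)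
    (hβ : β = 2 * Real.log (H' * m / δ)) :
    H' * (m * ((m - 1) * (Real.exp (-β) + Real.exp (-(2 * β))))) ≤ δ := by
  have hN : 0 < H' * m := by positivity
  set x := δ / (H' * m) with hx
  have hx0 : 0 < x := by positivity
  have hlog : Real.log (H' * m / δ) = - Real.log x := by
    rw [hx, ← Real.log_inv, inv_div]
  have e1 : Real.exp (-β) = x ^ 2 := by
    rw [hβ, hlog, show -(2 * -Real.log x) = ((2 : ℕ) : ℝ) * Real.log x by push_cast; ring,
      Real.exp_nat_mul, Real.exp_log hx0]
  have e2 : Real.exp (-(2 * β)) = x ^ 4 := by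
    rw [hβ, hlog, show -(2 * (2 * -Real.log x)) = ((4 : ℕ) : ℝ) * Real.log x by push_cast; ring,
      Real.exp_nat_mul, Real.exp_log hx0]
  rw [e1, e2]
  have hNx : H' * m * x = δ := by rw [hx]; field_simp
  have hxm : m * x ≤ 1 := by
    have : m * x ≤ H' * (m * x) := le_mul_of_one_le_left (by positivity) hH
    nlinarith
  have hx1 : x ≤ 1 := by nlinarith
  have h5 : (m - 1) * (x + x ^ 3) ≤ 1 := by
    have h6 : x ^ 3 ≤ x := by nlinarith [sq_nonneg x, mul_nonneg hx0.le (sub_nonneg.2 hx1)]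
    have h7 : (m - 1) * x ≤ 1 - x := by nlinarith
    have h8 : x ^ 3 * (m - 1) ≤ x ^ 2 * (1 - x) := by nlinarith [sq_nonneg x]
    nlinarith
  calc _ = (H' * m * x) * ((m - 1) * (x + x ^ 3)) := by ring
    _ ≤ δ := by rw [hNx]; nlinarith

lemma measure_exists_not_goodAt_le [NeZero H] {Ω : Type*} [MeasurableSpace Ω] {μ : Measure Ω}
    {M : MDP X A H} {ν : Fin H → Measure (X × A)}
    [∀ h, IsProbabilityMeasure (ν h)] {P : Fin H → Finset (CondDist X A lam)}
    (hP : ∀ h, (P h).Nonempty) {greedy : (Fin H → CondDist X A lam) → Policy X A H}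
    {D : Ω → Dataset X A H n} {Z : Ω → TargetDraws X A H n}
    (hn : 0 < n) (hs : IsSample μ M ν P (greedy '' tuples P) D Z)
    {qs : Fin H → Kernel (X × A) ℝ → Policy X A H → CondDist X A lam}
    (hqs : ∀ h, ∀ p ∈ tuples P, ∀ π ∈ greedy '' tuples P, qs h (nextDist p h) π ∈ P h ∧
      (qs h (nextDist p h) π).toKernel = distBellman M π h (nextDist p h))
    {δ β : ℝ} (hδ : 0 < δ) (hδ1 : δ < 1) (hβ0 : 0 ≤ β)
    (hβ : β = 2 * Real.log (H * (∏ h, ((P h).card : ℝ)) / δ)) :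
    μ {ω | ∃ h, ∃ p ∈ tuples P, ∃ π ∈ greedy '' tuples P,
      ¬ GoodAt ν β qs (D ω) (Z ω) h p π} ≤ ENNReal.ofReal δ := by
  classical
  set T := Fintype.piFinset P with hT
  have hTm : ∀ p, p ∈ T ↔ p ∈ tuples P := fun p => Fintype.mem_piFinset
  have hTne : T.Nonempty := Fintype.piFinset_nonempty.2 hP
  have hm : (∏ h, ((P h).card : ℝ)) = T.card := by
    rw [hT, Fintype.card_piFinset]; push_cast; rfl
  have hm1 : 1 ≤ T.card := hTne.card_pos
  set ε := Real.exp (-β) + Real.exp (-(2 * β))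
  have hone : ∀ h : Fin H, ∀ p' ∈ T,
      ∑ p ∈ T, μ {ω | ¬ GoodAt ν β qs (D ω) (Z ω) h p (greedy p')} ≤
        ENNReal.ofReal ((T.card - 1) * ε) := by
    intro h p' hp'
    have hπ : greedy p' ∈ greedy '' tuples P := ⟨p', (hTm p').1 hp', rfl⟩
    obtain ⟨p0, hp0⟩ := hTne
    have hp0' := (hTm p0).1 hp0
    -- This tuple carries its own Bellman target at step `h`, so it is good with certainty. Dropping
    -- it from the sum gives the factor `T.card - 1`.
    set p1 := Function.update p0 h (qs h (nextDist p0 h) (greedy p')) with hp1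
    have hp1T : p1 ∈ T := (hTm p1).2 (update_mem_tuples hp0' (hqs h p0 hp0' _ hπ).1)
    have hzero : μ {ω | ¬ GoodAt ν β qs (D ω) (Z ω) h p1 (greedy p')} = 0 := by
      have : ∀ ω, GoodAt ν β qs (D ω) (Z ω) h p1 (greedy p') := fun ω => by
        refine goodAt_of_eq hβ0 ?_
        rw [hp1, nextDist_update_of_le _ _ le_rfl]
        simp
      simp [this]
    rw [← Finset.add_sum_erase T _ hp1T, hzero, zero_add]
    calc _ ≤ ∑ p ∈ T.erase p1, ENNReal.ofReal ε := by
          refine Finset.sum_le_sum fun p hp => ?_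
          have hpT := (hTm p).1 (Finset.mem_of_mem_erase hp)
          exact not_goodAt_measure_le hn hs β hpT hπ (hqs h p hpT _ hπ).2
      _ = _ := by
          rw [Finset.sum_const, Finset.card_erase_of_mem hp1T, nsmul_eq_mul,
            ENNReal.ofReal_mul (by simpa using hm1), ← ENNReal.ofReal_natCast,
            Nat.cast_sub hm1, Nat.cast_one]
  have hsub : {ω | ∃ h, ∃ p ∈ tuples P, ∃ π ∈ greedy '' tuples P,
      ¬ GoodAt ν β qs (D ω) (Z ω) h p π} ⊆ ⋃ h ∈ (Finset.univ : Finset (Fin H)), ⋃ p' ∈ T,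
        ⋃ p ∈ T, {ω | ¬ GoodAt ν β qs (D ω) (Z ω) h p (greedy p')} := by
    rintro ω ⟨h, p, hp, _, ⟨p', hp', rfl⟩, hbad⟩
    simp only [Set.mem_iUnion]
    exact ⟨h, Finset.mem_univ h, p', (hTm p').2 hp', p, (hTm p).2 hp, hbad⟩
  calc _ ≤ ∑ h : Fin H, ∑ p' ∈ T, ∑ p ∈ T,
        μ {ω | ¬ GoodAt ν β qs (D ω) (Z ω) h p (greedy p')} := by
        refine (measure_mono hsub).trans ((measure_biUnion_finset_le _ _).trans ?_)
        refine Finset.sum_le_sum fun h _ => (measure_biUnion_finset_le _ _).trans ?_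
        exact Finset.sum_le_sum fun p' _ => measure_biUnion_finset_le _ _
    _ ≤ ∑ h : Fin H, ∑ p' ∈ T, ENNReal.ofReal ((T.card - 1) * ε) :=
        Finset.sum_le_sum fun h _ => Finset.sum_le_sum fun p' hp' => hone h p' hp'
    _ = ENNReal.ofReal (H * (T.card * ((T.card - 1) * ε))) := by
        rw [ENNReal.ofReal_mul (p := (H : ℝ)) (Nat.cast_nonneg _),
          ENNReal.ofReal_mul (p := (T.card : ℝ)) (Nat.cast_nonneg _)]
        simp
    _ ≤ _ := by
        refine ENNReal.ofReal_le_ofReal (union_bound_le ?_ ?_ hδ hδ1 (by rw [hβ, hm]))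
        · exact_mod_cast NeZero.one_le
        · exact_mod_cast hm1

/-! ### Constants and the main theorem. -/

lemma regret_arith {h σ Δ : ℝ} (hh : 1 ≤ h) (hΔ : 0 ≤ Δ) :
    2 * h * √(10 * Δ) * √σ + 4 * h ^ 2 * (10 * Δ) ≤
      40 * (h * √(σ * Δ) + h ^ (5 / 2 : ℝ) * Δ) := by
  have h1 : √(10 * Δ) * √σ = √10 * √(σ * Δ) := by
    rw [← Real.sqrt_mul (by positivity), ← Real.sqrt_mul (by norm_num)]
    ring_nf
  have h2 : √10 ≤ 4 := Real.sqrt_le_iff.2 ⟨by norm_num, by norm_num⟩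
  -- The argument yields the power `h ^ 2` in the lower-order term, which is weakened here to the
  -- exponent `5/2`.
  have h3 : h ^ 2 ≤ h ^ (5 / 2 : ℝ) := by
    rw [← Real.rpow_natCast]
    exact Real.rpow_le_rpow_of_exponent_le hh (by norm_num)
  have h4 : h ^ 2 * Δ ≤ h ^ (5 / 2 : ℝ) * Δ := by gcongr
  have h5 : √10 * (h * √(σ * Δ)) ≤ 4 * (h * √(σ * Δ)) := by gcongr
  have h6 : 0 ≤ h * √(σ * Δ) := by positivity
  calc _ = 2 * (√10 * (h * √(σ * Δ))) + 40 * (h ^ 2 * Δ) := by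
        rw [mul_assoc (2 * h), h1]; ring
    _ ≤ _ := by linarith

end OfflineDistRL

theorem mainTheorem8 :
    ∃ K : ℝ, 0 < K ∧
      ∀ (X : Type*) [MeasurableSpace X] (A : Type*) [MeasurableSpace A]
        (H : ℕ) [NeZero H] (M : MDP X A H)
        (lam : Measure ℝ) [SFinite lam], lam (Set.Icc (0 : ℝ) 1)ᶜ = 0 →
      ∀ (P : Fin H → Finset (CondDist X A lam)), (∀ h, (P h).Nonempty) →
      ∀ greedy : (Fin H → CondDist X A lam) → Policy X A H,
        (∀ p ∈ tuples P, IsGreedy p (greedy p)) →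
        DistBC M P (greedy '' tuples P) →
      ∀ (ν : Fin H → Measure (X × A)) [∀ h, IsProbabilityMeasure (ν h)]
        (n : ℕ), 0 < n →
      ∀ (Ω : Type*) [MeasurableSpace Ω] (μ : Measure Ω) [IsProbabilityMeasure μ]
        (D : Ω → Dataset X A H n) (Z : Ω → TargetDraws X A H n),
        IsSample μ M ν P (greedy '' tuples P) D Z →
      ∀ δ : ℝ, 0 < δ → δ < 1 →
      ∀ β : ℝ, β = 2 * Real.log (H * (∏ h, ((P h).card : ℝ)) / δ) →
      ∃ E : Set Ω, MeasurableSet E ∧ ENNReal.ofReal (1 - δ) ≤ μ E ∧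
        ∀ ω ∈ E,
          (∃ πhat, IsOutput M P (greedy '' tuples P) β (D ω) (Z ω) πhat) ∧
          ∀ πhat, IsOutput M P (greedy '' tuples P) β (D ω) (Z ω) πhat →
          ∀ πtilde ∈ greedy '' tuples P, coverage M ν πtilde ≠ ⊤ →
            value M πhat - value M πtilde ≤
              K * (H * √(returnVariance M πtilde *
                      ((coverage M ν πtilde).toReal * β / n))
                + (H : ℝ) ^ (5 / 2 : ℝ) * ((coverage M ν πtilde).toReal * β / n)) := by
  refine ⟨40, by norm_num, ?_⟩
  intro X _ A _ H _ M lam _ hlam P hP greedy _ hBC ν _ n hn Ω _ μ _ D Z hs δ hδ hδ1 β hβ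
  have hH : (1 : ℝ) ≤ H := by exact_mod_cast NeZero.one_le
  have hβ0 : 0 ≤ β := by
    rw [hβ]
    refine mul_nonneg zero_le_two (Real.log_nonneg ((one_le_div hδ).2 ?_))
    have hprod : (1 : ℝ) ≤ ∏ h, ((P h).card : ℝ) := by
      rw [← Nat.cast_prod]
      exact_mod_cast Finset.prod_pos fun h _ => (hP h).card_pos
    nlinarith
  -- The target selector is defined for all kernels; where no element of `P h` represents the
  -- Bellman image, an arbitrary element is taken and nothing is claimed.
  have hex : ∀ h g π, ∃ q, (∃ r ∈ P h, r.toKernel = distBellman M π h g) →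
      q ∈ P h ∧ q.toKernel = distBellman M π h g := fun h g π => by
    by_cases hr : ∃ r ∈ P h, r.toKernel = distBellman M π h g
    · exact hr.imp fun r hr' _ => hr'
    · exact ⟨(hP h).choose, fun hr' => absurd hr' hr⟩
  choose qs hqs' using hex
  have hqs : ∀ h, ∀ p ∈ tuples P, ∀ π ∈ greedy '' tuples P, qs h (nextDist p h) π ∈ P h ∧
      (qs h (nextDist p h) π).toKernel = distBellman M π h (nextDist p h) :=
    fun h p hp π hπ => hqs' h _ π (hBC h p hp π hπ)
  set Bad : Set Ω := {ω | ∃ h, ∃ p ∈ tuples P, ∃ π ∈ greedy '' tuples P,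
      ¬ GoodAt ν β qs (D ω) (Z ω) h p π}
  have hprob : μ Bad ≤ ENNReal.ofReal δ :=
    measure_exists_not_goodAt_le hP hn hs hqs hδ hδ1 hβ0 hβ
  -- The bad set need not be measurable, so it is replaced by a measurable hull of the same measure.
  refine ⟨(toMeasurable μ Bad)ᶜ, (measurableSet_toMeasurable _ _).compl, ?_, fun ω hω => ?_⟩
  · rw [prob_compl_eq_one_sub (measurableSet_toMeasurable _ _), measure_toMeasurable,
      ENNReal.ofReal_sub _ hδ.le, ENNReal.ofReal_one]
    gcongr
  · have hgood : ∀ h, ∀ p ∈ tuples P, ∀ π ∈ greedy '' tuples P,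
        GoodAt ν β qs (D ω) (Z ω) h p π := by
      intro h p hp π hπ
      by_contra hc
      exact hω (subset_toMeasurable μ Bad ⟨h, p, hp, π, hπ, hc⟩)
    have htne : (tuples P).Nonempty := ⟨fun h => (hP h).choose, fun h => (hP h).choose_spec⟩
    refine ⟨exists_isOutput ((tuples_finite P).image _) (htne.image _) fun π hπ => ?_,
      fun πhat hout πtilde htilde hC => ?_⟩
    · obtain ⟨p, hp, -⟩ := exists_isExact_mem_versionSpace (M := M) hP
        (fun h p hp => hqs h p hp π hπ) (fun h p hp => hgood h p hp π hπ)
      exact ⟨p, hp⟩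
    · exact (value_sub_value_le hlam hP hβ0 hqs hgood hout htilde hC).trans
        (regret_arith hH (by positivity))
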